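/- Let $A$ be a Hopf algebra over $\mathbb C$ with coproduct $\Delta$ and antipode $S$, and let $(E,d)$ be a bicovariant first order differential calculus over $A$: $E$ is an $A$-bimodule, $d:A\to E$ is linear with $d(ab)=(da)b+a\,db$, every element of $E$ is a finite sum $\sum_k a_k\,db_k$, and $\sum_k a_k\,db_k=0$ implies both $\sum_k\Delta(a_k)(\mathrm{id}\otimes d)\Delta(b_k)=0$ and $\sum_k\Delta(a_k)(d\otimes\mathrm{id})\Delta(b_k)=0$. Let $\Delta_E(a\,db)=\Delta(a)(\mathrm{id}\otimes d)\Delta(b)$ and ${}_E\Delta(a\,db)=\Delta(a)(d\otimes\mathrm{id})\Delta(b)$ be the resulting left and right coactions on $E$, and equip $E\otimes_AE$ with the diagonal left and right coactions $\Delta_{E\otimes_AE}$ and ${}_{E\otimes_AE}\Delta$. Write ${}_0E=\{\omega\in E:\Delta_E(\omega)=1\otimes\omega\}$, ${}_0(E\otimes_AE)=\{x\in E\otimes_AE:\Delta_{E\otimes_AE}(x)=1\otimes x\}$ and $E_0=\{\eta\in E:{}_E\Delta(\eta)=\eta\otimes1\}$, and assume that ${}_0E$ is finite dimensional. Let $\sigma$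 be the canonical braiding, i.e. the unique bimodule endomorphism of $E\otimes_AE$ with $\sigma(\omega\otimes_A\eta)=\eta\otimes_A\omega$ for $\omega\in{}_0E$, $\eta\in E_0$; it restricts to an endomorphism ${}_0\sigma$ of ${}_0(E\otimes_AE)={}_0E\otimes_{\mathbb C}{}_0E$. Let $\Omega^2(A)=(E\otimes_AE)/\ker(\sigma-1)$ with quotient map $\wedge$, and let $d:E\to\Omega^2(A)$ be given by $d(a\,db)=da\wedge db$. A (right) connection on $E$ is a linear map $\nabla:E\to E\otimes_AE$ with $\nabla(\rho a)=\nabla(\rho)a+\rho\otimes_Ada$ for all $\rho\in E$, $a\in A$. It is torsionless if $\wedge\circ\nabla+d=0$, and bicovariant if $(\mathrm{id}\otimes\nabla)\Delta_E=\Delta_{E\otimes_AE}\nabla$ and $(\nabla\otimes\mathrm{id})\,{}_E\Delta={}_{E\otimes_AE}\Delta\,\nabla$. Suppose that ${}_0\sigma$ is diagonalisable. Then $E$ admits a bicovariant torsionless connection. Moreover, suppose that the antipode $S$ is bijective, let ${}_0F$ be the sum of the eigenspaces of ${}_0\sigma$ for eigenvalues other than $1$, and let $F={}_0F\cdot A\subseteq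 E\otimes_AE$. Then $Q=\wedge|_F:F\to\Omega^2(A)$ is bijective, there is exactly one connection $\nabla_0$ on $E$ with $\nabla_0(\omega)=Q^{-1}(-d\omega)$ for all $\omega\in{}_0E$, and $\nabla_0$ is bicovariant and torsionless. -/

import Mathlib

open TensorProduct MulOpposite

set_option linter.unusedSectionVars false
set_option linter.unusedSimpArgs false

noncomputable section

namespace QuantumCalculus

variable {A : Type*} [Ring A] [HopfAlgebra ℂ A]
variable {E : Type*} [AddCommGroup E] [Module ℂ E] [Module A E] [Module Aᵐᵒᵖ E]
  [IsScalarTower ℂ A E] [IsScalarTower ℂ Aᵐᵒᵖ E] [SMulCommClass A Aᵐᵒᵖ E]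

section Actions

variable (A E)

/-- The left action `a ⊗ e ↦ a e` as a bilinear map. -/
def lAct : A →ₗ[ℂ] E →ₗ[ℂ] E :=
  LinearMap.mk₂ ℂ (fun a e => a • e) add_smul (fun c a e => smul_assoc c a e) smul_add
    (fun c a e => smul_comm a c e)

/-- The right action `e ⊗ a ↦ e a` as a bilinear map. -/
def rAct : E →ₗ[ℂ] A →ₗ[ℂ] E :=
  LinearMap.mk₂ ℂ (fun e a => op a • e) (fun e f a => smul_add _ e f)
    (fun c e a => smul_comm (op a) c e) (fun e a b => by rw [op_add, add_smul])
    (fun c e a => by rw [op_smul, smul_assoc])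

@[simp] theorem lAct_apply (a : A) (e : E) : lAct A E a e = a • e := rfl
@[simp] theorem rAct_apply (e : E) (a : A) : rAct A E e a = op a • e := rfl

/-- `(a ⊗ b) (c ⊗ e) = ac ⊗ be`, the left action of `A ⊗ A` on `A ⊗ E`. -/
def lmulL : A ⊗[ℂ] A →ₗ[ℂ] A ⊗[ℂ] E →ₗ[ℂ] A ⊗[ℂ] E := map₂ (LinearMap.mul ℂ A) (lAct A E)

/-- `(c ⊗ e) (a ⊗ b) = ca ⊗ eb`, the right action of `A ⊗ A` on `A ⊗ E`. -/
def rmulL : A ⊗[ℂ] E →ₗ[ℂ] A ⊗[ℂ] A →ₗ[ℂ] A ⊗[ℂ] E := map₂ (LinearMap.mul ℂ A) (rAct A E)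

/-- `(a ⊗ b) (e ⊗ c) = ae ⊗ bc`, the left action of `A ⊗ A` on `E ⊗ A`. -/
def lmulR : A ⊗[ℂ] A →ₗ[ℂ] E ⊗[ℂ] A →ₗ[ℂ] E ⊗[ℂ] A := map₂ (lAct A E) (LinearMap.mul ℂ A)

/-- `(e ⊗ c) (a ⊗ b) = ea ⊗ cb`, the right action of `A ⊗ A` on `E ⊗ A`. -/
def rmulR : E ⊗[ℂ] A →ₗ[ℂ] A ⊗[ℂ] A →ₗ[ℂ] E ⊗[ℂ] A := map₂ (rAct A E) (LinearMap.mul ℂ A)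

@[simp] theorem lmulL_tmul (a b c : A) (e : E) :
    lmulL A E (a ⊗ₜ b) (c ⊗ₜ e) = (a * c) ⊗ₜ (b • e) := rfl
@[simp] theorem rmulL_tmul (a b c : A) (e : E) :
    rmulL A E (c ⊗ₜ e) (a ⊗ₜ b) = (c * a) ⊗ₜ (op b • e) := rfl
@[simp] theorem lmulR_tmul (a b c : A) (e : E) :
    lmulR A E (a ⊗ₜ b) (e ⊗ₜ c) = (a • e) ⊗ₜ (b * c) := rfl
@[simp] theorem rmulR_tmul (a b c : A) (e : E) :
    rmulR A E (e ⊗ₜ c) (a ⊗ₜ b) = (op a • e) ⊗ₜ (c * b) := rfl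

variable {A E}

theorem lmulL_mul (s t : A ⊗[ℂ] A) (x : A ⊗[ℂ] E) :
    lmulL A E (s * t) x = lmulL A E s (lmulL A E t x) := by
  induction s using TensorProduct.induction_on with
  | zero => simp
  | add s s' h h' => simp [add_mul, h, h']
  | tmul a b =>
  induction t using TensorProduct.induction_on with
  | zero => simp
  | add s s' h h' => simp [mul_add, h, h']
  | tmul a' b' =>
  induction x using TensorProduct.induction_on with
  | zero => simp
  | add s s' h h' => simp only [map_add, h, h']
  | tmul c e => simp [mul_assoc, mul_smul]

theorem lmulR_mul (s t : A ⊗[ℂ] A) (x : E ⊗[ℂ] A) :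
    lmulR A E (s * t) x = lmulR A E s (lmulR A E t x) := by
  induction s using TensorProduct.induction_on with
  | zero => simp
  | add s s' h h' => simp [add_mul, h, h']
  | tmul a b =>
  induction t using TensorProduct.induction_on with
  | zero => simp
  | add s s' h h' => simp [mul_add, h, h']
  | tmul a' b' =>
  induction x using TensorProduct.induction_on with
  | zero => simp
  | add s s' h h' => simp only [map_add, h, h']
  | tmul c e => simp [mul_assoc, mul_smul]

theorem lmulL_rmulL (s t : A ⊗[ℂ] A) (x : A ⊗[ℂ] E) :
    lmulL A E s (rmulL A E x t) = rmulL A E (lmulL A E s x) t := by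
  induction s using TensorProduct.induction_on with
  | zero => simp
  | add s s' h h' => simp [h, h']
  | tmul a b =>
  induction t using TensorProduct.induction_on with
  | zero => simp
  | add s s' h h' => simp only [map_add, h, h']
  | tmul a' b' =>
  induction x using TensorProduct.induction_on with
  | zero => simp
  | add s s' h h' => simp only [map_add, LinearMap.add_apply, h, h']
  | tmul c e => simp [mul_assoc, smul_comm]

theorem lmulR_rmulR (s t : A ⊗[ℂ] A) (x : E ⊗[ℂ] A) :
    lmulR A E s (rmulR A E x t) = rmulR A E (lmulR A E s x) t := by
  induction s using TensorProduct.induction_on with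
  | zero => simp
  | add s s' h h' => simp [h, h']
  | tmul a b =>
  induction t using TensorProduct.induction_on with
  | zero => simp
  | add s s' h h' => simp only [map_add, h, h']
  | tmul a' b' =>
  induction x using TensorProduct.induction_on with
  | zero => simp
  | add s s' h h' => simp only [map_add, LinearMap.add_apply, h, h']
  | tmul c e => simp [mul_assoc, smul_comm]

end Actions

open Coalgebra HopfAlgebra

variable (A E) in
/-- A first order differential calculus `(E, d)` over `A`. -/
structure FirstOrderCalculus where
  d : A →ₗ[ℂ] E
  leibniz : ∀ a b : A, d (a * b) = op b • d a + a • d b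
  exists_sum : ∀ ρ : E, ∃ (n : ℕ) (a b : Fin n → A), ρ = ∑ k, a k • d (b k)

variable (A E) in
/-- A bicovariant first order differential calculus over the Hopf algebra `A`. -/
structure BicovariantCalculus extends FirstOrderCalculus A E where
  leftCovariant : ∀ (n : ℕ) (a b : Fin n → A), ∑ k, a k • d (b k) = 0 →
    ∑ k, lmulL A E (comul (a k)) (d.lTensor A (comul (b k))) = 0
  rightCovariant : ∀ (n : ℕ) (a b : Fin n → A), ∑ k, a k • d (b k) = 0 →
    ∑ k, lmulR A E (comul (a k)) (d.rTensor A (comul (b k))) = 0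

namespace BicovariantCalculus

variable (C : BicovariantCalculus A E)

/-- `a ⊗ b ↦ a db`. -/
def form : A ⊗[ℂ] A →ₗ[ℂ] E := lift ((lAct A E).compl₂ C.d)

@[simp] theorem form_tmul (a b : A) : C.form (a ⊗ₜ b) = a • C.d b := rfl

theorem exists_fin_sum (t : A ⊗[ℂ] A) :
    ∃ (n : ℕ) (a b : Fin n → A), t = ∑ k, a k ⊗ₜ[ℂ] b k := by
  obtain ⟨S, h⟩ := TensorProduct.exists_finset t
  refine ⟨S.card, fun k => (S.equivFin.symm k).1.1, fun k => (S.equivFin.symm k).1.2, ?_⟩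
  rw [h, ← Finset.sum_coe_sort S]
  exact (Equiv.sum_comp S.equivFin.symm (fun i => i.1.1 ⊗ₜ[ℂ] i.1.2)).symm

theorem form_surjective : Function.Surjective C.form := by
  intro ρ
  obtain ⟨n, a, b, h⟩ := C.exists_sum ρ
  exact ⟨∑ k, a k ⊗ₜ b k, by simp [h]⟩

/-- The linear map on `E` that sends `a db` to `f (a ⊗ b)`. -/
def extend {V : Type*} [AddCommGroup V] [Module ℂ V] (f : A ⊗[ℂ] A →ₗ[ℂ] V)
    (hf : LinearMap.ker C.form ≤ LinearMap.ker f) : E →ₗ[ℂ] V :=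
  (LinearMap.ker C.form).liftQ f hf ∘ₗ
    (C.form.quotKerEquivOfSurjective C.form_surjective).symm.toLinearMap

theorem extend_form {V : Type*} [AddCommGroup V] [Module ℂ V] (f : A ⊗[ℂ] A →ₗ[ℂ] V)
    (hf : LinearMap.ker C.form ≤ LinearMap.ker f) (t : A ⊗[ℂ] A) :
    C.extend f hf (C.form t) = f t := by
  have : (C.form.quotKerEquivOfSurjective C.form_surjective).symm (C.form t) =
      (LinearMap.ker C.form).mkQ t := by
    rw [LinearEquiv.symm_apply_eq]; rfl
  simp [extend, this]

theorem ext_form {V : Type*} [AddCommGroup V] [Module ℂ V] {f g : E →ₗ[ℂ] V}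
    (h : ∀ a b : A, f (a • C.d b) = g (a • C.d b)) : f = g := by
  ext ρ
  obtain ⟨n, a, b, rfl⟩ := C.exists_sum ρ
  simp [h]

theorem leftCoaction_aux : LinearMap.ker C.form ≤ LinearMap.ker
    (lift ((lmulL A E).compl₁₂ comul (C.d.lTensor A ∘ₗ comul))) := by
  intro t ht
  obtain ⟨n, a, b, rfl⟩ := exists_fin_sum t
  simpa using C.leftCovariant n a b (by simpa using ht)

theorem rightCoaction_aux : LinearMap.ker C.form ≤ LinearMap.ker
    (lift ((lmulR A E).compl₁₂ comul (C.d.rTensor A ∘ₗ comul))) := by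
  intro t ht
  obtain ⟨n, a, b, rfl⟩ := exists_fin_sum t
  simpa using C.rightCovariant n a b (by simpa using ht)

/-- The left coaction `Δ_E : E → A ⊗ E`, `a db ↦ Δ(a) (id ⊗ d)Δ(b)`. -/
def ΔL : E →ₗ[ℂ] A ⊗[ℂ] E := C.extend _ C.leftCoaction_aux

/-- The right coaction `_EΔ : E → E ⊗ A`, `a db ↦ Δ(a) (d ⊗ id)Δ(b)`. -/
def ΔR : E →ₗ[ℂ] E ⊗[ℂ] A := C.extend _ C.rightCoaction_aux

theorem ΔL_form (a b : A) :
    C.ΔL (a • C.d b) = lmulL A E (comul a) (C.d.lTensor A (comul b)) := by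
  rw [← form_tmul, ΔL, extend_form]; rfl

theorem ΔR_form (a b : A) :
    C.ΔR (a • C.d b) = lmulR A E (comul a) (C.d.rTensor A (comul b)) := by
  rw [← form_tmul, ΔR, extend_form]; rfl

theorem lmulL_one (x : A ⊗[ℂ] E) : lmulL A E 1 x = x := by
  induction x using TensorProduct.induction_on with
  | zero => simp
  | add s s' h h' => simp only [map_add, h, h']
  | tmul c e => simp [Algebra.TensorProduct.one_def]

theorem lmulR_one (x : E ⊗[ℂ] A) : lmulR A E 1 x = x := by
  induction x using TensorProduct.induction_on with
  | zero => simp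
  | add s s' h h' => simp only [map_add, h, h']
  | tmul c e => simp [Algebra.TensorProduct.one_def]

theorem ΔL_d (b : A) : C.ΔL (C.d b) = C.d.lTensor A (comul b) := by
  have := C.ΔL_form 1 b
  rwa [one_smul, Bialgebra.comul_one, lmulL_one] at this

theorem ΔR_d (b : A) : C.ΔR (C.d b) = C.d.rTensor A (comul b) := by
  have := C.ΔR_form 1 b
  rwa [one_smul, Bialgebra.comul_one, lmulR_one] at this

theorem ΔL_smul (a : A) (e : E) : C.ΔL (a • e) = lmulL A E (comul a) (C.ΔL e) := by
  obtain ⟨n, c, b, rfl⟩ := C.exists_sum e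
  simp only [Finset.smul_sum, map_sum, smul_smul, ΔL_form, Bialgebra.comul_mul, lmulL_mul]

theorem ΔR_smul (a : A) (e : E) : C.ΔR (a • e) = lmulR A E (comul a) (C.ΔR e) := by
  obtain ⟨n, c, b, rfl⟩ := C.exists_sum e
  simp only [Finset.smul_sum, map_sum, smul_smul, ΔR_form, Bialgebra.comul_mul, lmulR_mul]

theorem lTensor_d_mul (s t : A ⊗[ℂ] A) : C.d.lTensor A (s * t) =
    rmulL A E (C.d.lTensor A s) t + lmulL A E s (C.d.lTensor A t) := by
  induction s using TensorProduct.induction_on with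
  | zero => simp
  | add s s' h h' => simp only [add_mul, h, h', map_add, LinearMap.add_apply]; abel
  | tmul a b =>
  induction t using TensorProduct.induction_on with
  | zero => simp
  | add s s' h h' => simp only [mul_add, h, h', map_add]; abel
  | tmul a' b' => simp [C.leibniz, tmul_add]

theorem rTensor_d_mul (s t : A ⊗[ℂ] A) : C.d.rTensor A (s * t) =
    rmulR A E (C.d.rTensor A s) t + lmulR A E s (C.d.rTensor A t) := by
  induction s using TensorProduct.induction_on with
  | zero => simp
  | add s s' h h' => simp only [add_mul, h, h', map_add, LinearMap.add_apply]; abel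
  | tmul a b =>
  induction t using TensorProduct.induction_on with
  | zero => simp
  | add s s' h h' => simp only [mul_add, h, h', map_add]; abel
  | tmul a' b' => simp [C.leibniz, add_tmul]

theorem form_op_smul (a b c : A) :
    op c • (a • C.d b) = a • C.d (b * c) - (a * b) • C.d c := by
  rw [C.leibniz, smul_add, smul_smul, add_sub_cancel_right, smul_comm a (op c)]

theorem ΔL_op_smul (c : A) (e : E) : C.ΔL (op c • e) = rmulL A E (C.ΔL e) (comul c) := by
  obtain ⟨n, a, b, rfl⟩ := C.exists_sum e
  simp only [Finset.smul_sum, map_sum, form_op_smul, map_sub, ΔL_form, Bialgebra.comul_mul,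
    lmulL_mul, lTensor_d_mul, map_add, add_sub_cancel_right, lmulL_rmulL, LinearMap.sum_apply]

theorem ΔR_op_smul (c : A) (e : E) : C.ΔR (op c • e) = rmulR A E (C.ΔR e) (comul c) := by
  obtain ⟨n, a, b, rfl⟩ := C.exists_sum e
  simp only [Finset.smul_sum, map_sum, form_op_smul, map_sub, ΔR_form, Bialgebra.comul_mul,
    lmulR_mul, rTensor_d_mul, map_add, add_sub_cancel_right, lmulR_rmulR, LinearMap.sum_apply]


section Comodule

theorem counit_ΔL (e : E) :
    TensorProduct.lid ℂ E ((counit (R := ℂ) (A := A)).rTensor E (C.ΔL e)) = e := by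
  have h : ∀ s t : A ⊗[ℂ] A, TensorProduct.lid ℂ E ((counit (R := ℂ) (A := A)).rTensor E
      (lmulL A E s (C.d.lTensor A t))) =
      lAct A E (TensorProduct.lid ℂ A ((counit (R := ℂ)).rTensor A s))
        (C.d (TensorProduct.lid ℂ A ((counit (R := ℂ)).rTensor A t))) := by
    intro s t
    induction s using TensorProduct.induction_on with
    | zero => simp
    | add s s' h h' => simp only [map_add, LinearMap.add_apply, h, h']
    | tmul a b =>
    induction t using TensorProduct.induction_on with
    | zero => simp
    | add s s' h h' => simp only [map_add, h, h']
    | tmul a' b' =>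
      simp [mul_smul]
      exact smul_comm _ _ _
  obtain ⟨n, a, b, rfl⟩ := C.exists_sum e
  simp [ΔL_form, h]

theorem counit_ΔR (e : E) :
    TensorProduct.rid ℂ E ((counit (R := ℂ) (A := A)).lTensor E (C.ΔR e)) = e := by
  have h : ∀ s t : A ⊗[ℂ] A, TensorProduct.rid ℂ E ((counit (R := ℂ) (A := A)).lTensor E
      (lmulR A E s (C.d.rTensor A t))) =
      lAct A E (TensorProduct.rid ℂ A ((counit (R := ℂ)).lTensor A s))
        (C.d (TensorProduct.rid ℂ A ((counit (R := ℂ)).lTensor A t))) := by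
    intro s t
    induction s using TensorProduct.induction_on with
    | zero => simp
    | add s s' h h' => simp only [map_add, LinearMap.add_apply, h, h']
    | tmul a b =>
    induction t using TensorProduct.induction_on with
    | zero => simp
    | add s s' h h' => simp only [map_add, h, h']
    | tmul a' b' =>
      simp [mul_smul]
      exact smul_comm _ _ _
  obtain ⟨n, a, b, rfl⟩ := C.exists_sum e
  simp [ΔR_form, h]

/-- `(a ⊗ b ⊗ c, a' ⊗ b' ⊗ c') ↦ aa' ⊗ bb' ⊗ c dc'`. -/
def tripleLL : A ⊗[ℂ] (A ⊗[ℂ] A) →ₗ[ℂ] A ⊗[ℂ] (A ⊗[ℂ] A) →ₗ[ℂ] A ⊗[ℂ] (A ⊗[ℂ] E) :=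
  map₂ (LinearMap.mul ℂ A) (map₂ (LinearMap.mul ℂ A) ((lAct A E).compl₂ C.d))

/-- `(a ⊗ b ⊗ c, a' ⊗ b' ⊗ c') ↦ aa' ⊗ b db' ⊗ cc'`. -/
def tripleLR : A ⊗[ℂ] (A ⊗[ℂ] A) →ₗ[ℂ] A ⊗[ℂ] (A ⊗[ℂ] A) →ₗ[ℂ] A ⊗[ℂ] (E ⊗[ℂ] A) :=
  map₂ (LinearMap.mul ℂ A) (map₂ ((lAct A E).compl₂ C.d) (LinearMap.mul ℂ A))

/-- `(a ⊗ b ⊗ c, a' ⊗ b' ⊗ c') ↦ a da' ⊗ bb' ⊗ cc'`. -/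
def tripleRR : A ⊗[ℂ] (A ⊗[ℂ] A) →ₗ[ℂ] A ⊗[ℂ] (A ⊗[ℂ] A) →ₗ[ℂ] E ⊗[ℂ] (A ⊗[ℂ] A) :=
  map₂ ((lAct A E).compl₂ C.d) (map₂ (LinearMap.mul ℂ A) (LinearMap.mul ℂ A))

theorem coassoc_ΔL (e : E) : TensorProduct.assoc ℂ A A E (comul.rTensor E (C.ΔL e)) =
    C.ΔL.lTensor A (C.ΔL e) := by
  have h₁ : ∀ s t : A ⊗[ℂ] A, C.ΔL.lTensor A (lmulL A E s (C.d.lTensor A t)) =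
      C.tripleLL (comul.lTensor A s) (comul.lTensor A t) := by
    intro s t
    induction s using TensorProduct.induction_on with
    | zero => simp
    | add s s' h h' => simp only [map_add, LinearMap.add_apply, h, h']
    | tmul a b =>
    induction t using TensorProduct.induction_on with
    | zero => simp
    | add s s' h h' => simp only [map_add, h, h']
    | tmul a' b' =>
      simp only [LinearMap.lTensor_tmul, lmulL_tmul, ΔL_form, tripleLL, map₂_apply_tmul, map_tmul,
        LinearMap.mul_apply']
      congr 1
      generalize comul (R := ℂ) b = u
      generalize comul (R := ℂ) b' = v
      induction u using TensorProduct.induction_on with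
      | zero => simp
      | add s s' h h' => simp only [map_add, LinearMap.add_apply, h, h']
      | tmul a b =>
      induction v using TensorProduct.induction_on with
      | zero => simp
      | add s s' h h' => simp only [map_add, h, h']
      | tmul a' b' => simp
  have h₂ : ∀ s t : A ⊗[ℂ] A, TensorProduct.assoc ℂ A A E
      (comul.rTensor E (lmulL A E s (C.d.lTensor A t))) =
      C.tripleLL (TensorProduct.assoc ℂ A A A (comul.rTensor A s))
        (TensorProduct.assoc ℂ A A A (comul.rTensor A t)) := by
    intro s t
    induction s using TensorProduct.induction_on with
    | zero => simp
    | add s s' h h' => simp only [map_add, LinearMap.add_apply, h, h']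
    | tmul a b =>
    induction t using TensorProduct.induction_on with
    | zero => simp
    | add s s' h h' => simp only [map_add, h, h']
    | tmul a' b' =>
      simp only [LinearMap.lTensor_tmul, LinearMap.rTensor_tmul, lmulL_tmul, Bialgebra.comul_mul]
      generalize comul (R := ℂ) a = u
      generalize comul (R := ℂ) a' = v
      induction u using TensorProduct.induction_on with
      | zero => simp
      | add s s' h h' => simp only [map_add, LinearMap.add_apply, add_mul, add_tmul, h, h']
      | tmul a b =>
      induction v using TensorProduct.induction_on with
      | zero => simp
      | add s s' h h' => simp only [map_add, mul_add, add_tmul, h, h']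
      | tmul a' b' => simp [tripleLL]
  obtain ⟨n, a, b, rfl⟩ := C.exists_sum e
  simp only [map_sum, ΔL_form, h₁, h₂, coassoc_apply]

theorem coassoc_ΔR (e : E) : TensorProduct.assoc ℂ E A A (C.ΔR.rTensor A (C.ΔR e)) =
    comul.lTensor E (C.ΔR e) := by
  have h₁ : ∀ s t : A ⊗[ℂ] A, comul.lTensor E (lmulR A E s (C.d.rTensor A t)) =
      C.tripleRR (comul.lTensor A s) (comul.lTensor A t) := by
    intro s t
    induction s using TensorProduct.induction_on with
    | zero => simp
    | add s s' h h' => simp only [map_add, LinearMap.add_apply, h, h']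
    | tmul a b =>
    induction t using TensorProduct.induction_on with
    | zero => simp
    | add s s' h h' => simp only [map_add, h, h']
    | tmul a' b' =>
      simp only [LinearMap.lTensor_tmul, LinearMap.rTensor_tmul, lmulR_tmul, tripleRR,
        map₂_apply_tmul, map_tmul, Bialgebra.comul_mul]
      congr 1
      generalize comul (R := ℂ) b = u
      generalize comul (R := ℂ) b' = v
      induction u using TensorProduct.induction_on with
      | zero => simp
      | add s s' h h' => simp only [map_add, LinearMap.add_apply, add_mul, h, h']
      | tmul a b =>
      induction v using TensorProduct.induction_on with
      | zero => simp
      | add s s' h h' => simp only [map_add, mul_add, h, h']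
      | tmul a' b' => simp
  have h₂ : ∀ s t : A ⊗[ℂ] A, TensorProduct.assoc ℂ E A A
      (C.ΔR.rTensor A (lmulR A E s (C.d.rTensor A t))) =
      C.tripleRR (TensorProduct.assoc ℂ A A A (comul.rTensor A s))
        (TensorProduct.assoc ℂ A A A (comul.rTensor A t)) := by
    intro s t
    induction s using TensorProduct.induction_on with
    | zero => simp
    | add s s' h h' => simp only [map_add, LinearMap.add_apply, h, h']
    | tmul a b =>
    induction t using TensorProduct.induction_on with
    | zero => simp
    | add s s' h h' => simp only [map_add, h, h']
    | tmul a' b' =>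
      simp only [LinearMap.rTensor_tmul, lmulR_tmul, ΔR_form]
      generalize comul (R := ℂ) a = u
      generalize comul (R := ℂ) a' = v
      induction u using TensorProduct.induction_on with
      | zero => simp
      | add s s' h h' => simp only [map_add, LinearMap.add_apply, add_tmul, h, h']
      | tmul a b =>
      induction v using TensorProduct.induction_on with
      | zero => simp
      | add s s' h h' => simp only [map_add, add_tmul, h, h']
      | tmul a' b' => simp [tripleRR]
  obtain ⟨n, a, b, rfl⟩ := C.exists_sum e
  simp only [map_sum, ΔR_form, h₁, h₂, coassoc_apply]

theorem ΔL_ΔR (e : E) : TensorProduct.assoc ℂ A E A (C.ΔL.rTensor A (C.ΔR e)) =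
    C.ΔR.lTensor A (C.ΔL e) := by
  have h₁ : ∀ s t : A ⊗[ℂ] A, C.ΔR.lTensor A (lmulL A E s (C.d.lTensor A t)) =
      C.tripleLR (comul.lTensor A s) (comul.lTensor A t) := by
    intro s t
    induction s using TensorProduct.induction_on with
    | zero => simp
    | add s s' h h' => simp only [map_add, LinearMap.add_apply, h, h']
    | tmul a b =>
    induction t using TensorProduct.induction_on with
    | zero => simp
    | add s s' h h' => simp only [map_add, h, h']
    | tmul a' b' =>
      simp only [LinearMap.lTensor_tmul, lmulL_tmul, ΔR_form, tripleLR, map₂_apply_tmul, map_tmul,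
        LinearMap.mul_apply']
      congr 1
      generalize comul (R := ℂ) b = u
      generalize comul (R := ℂ) b' = v
      induction u using TensorProduct.induction_on with
      | zero => simp
      | add s s' h h' => simp only [map_add, LinearMap.add_apply, h, h']
      | tmul a b =>
      induction v using TensorProduct.induction_on with
      | zero => simp
      | add s s' h h' => simp only [map_add, h, h']
      | tmul a' b' => simp
  have h₂ : ∀ s t : A ⊗[ℂ] A, TensorProduct.assoc ℂ A E A
      (C.ΔL.rTensor A (lmulR A E s (C.d.rTensor A t))) =
      C.tripleLR (TensorProduct.assoc ℂ A A A (comul.rTensor A s))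
        (TensorProduct.assoc ℂ A A A (comul.rTensor A t)) := by
    intro s t
    induction s using TensorProduct.induction_on with
    | zero => simp
    | add s s' h h' => simp only [map_add, LinearMap.add_apply, h, h']
    | tmul a b =>
    induction t using TensorProduct.induction_on with
    | zero => simp
    | add s s' h h' => simp only [map_add, h, h']
    | tmul a' b' =>
      simp only [LinearMap.rTensor_tmul, lmulR_tmul, ΔL_form]
      generalize comul (R := ℂ) a = u
      generalize comul (R := ℂ) a' = v
      induction u using TensorProduct.induction_on with
      | zero => simp
      | add s s' h h' => simp only [map_add, LinearMap.add_apply, add_tmul, h, h']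
      | tmul a b =>
      induction v using TensorProduct.induction_on with
      | zero => simp
      | add s s' h h' => simp only [map_add, add_tmul, h, h']
      | tmul a' b' => simp [tripleLR]
  obtain ⟨n, a, b, rfl⟩ := C.exists_sum e
  simp only [map_sum, ΔL_form, ΔR_form, h₁, h₂, coassoc_apply]

end Comodule

section Balanced

variable (A E) in
/-- The relations `ea ⊗ f = e ⊗ af`. -/
def balancedRel : Submodule ℂ (E ⊗[ℂ] E) :=
  Submodule.span ℂ {x | ∃ (e f : E) (a : A), x = (op a • e) ⊗ₜ f - e ⊗ₜ (a • f)}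

variable (A E) in
/-- The tensor product `E ⊗_A E` over the noncommutative algebra `A`. -/
abbrev TensorA : Type _ := (E ⊗[ℂ] E) ⧸ balancedRel A E

variable (A) in
/-- The elementary tensor `e ⊗_A f`. -/
def tmulA (e f : E) : TensorA A E := (balancedRel A E).mkQ (e ⊗ₜ f)

theorem tmulA_balanced (a : A) (e f : E) : tmulA A (op a • e) f = tmulA A e (a • f) := by
  rw [← sub_eq_zero, tmulA, tmulA, ← map_sub]
  exact (Submodule.Quotient.mk_eq_zero _).2 (Submodule.subset_span ⟨e, f, a, rfl⟩)

/-- A balanced linear map on `E ⊗ E` descends to `E ⊗_A E`. -/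
def liftA {V : Type*} [AddCommGroup V] [Module ℂ V] (f : E ⊗[ℂ] E →ₗ[ℂ] V)
    (hf : ∀ (a : A) (x y : E), f ((op a • x) ⊗ₜ y) = f (x ⊗ₜ (a • y))) : TensorA A E →ₗ[ℂ] V :=
  (balancedRel A E).liftQ f <| Submodule.span_le.2 <| by
    rintro _ ⟨x, y, a, rfl⟩
    simp [hf]

@[simp] theorem liftA_tmulA {V : Type*} [AddCommGroup V] [Module ℂ V] (f : E ⊗[ℂ] E →ₗ[ℂ] V)
    (hf : ∀ (a : A) (x y : E), f ((op a • x) ⊗ₜ y) = f (x ⊗ₜ (a • y))) (x y : E) :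
    liftA f hf (tmulA A x y) = f (x ⊗ₜ y) := by
  rfl

theorem ext_tmulA {V : Type*} [AddCommGroup V] [Module ℂ V] {f g : TensorA A E →ₗ[ℂ] V}
    (h : ∀ x y, f (tmulA A x y) = g (tmulA A x y)) : f = g :=
  Submodule.linearMap_qext _ (TensorProduct.ext' h)

/-- The left action of `a` on `E ⊗_A E`. -/
def lActA (a : A) : TensorA A E →ₗ[ℂ] TensorA A E :=
  liftA ((balancedRel A E).mkQ ∘ₗ (lAct A E a).rTensor E) fun b x y => by
    have := tmulA_balanced b (a • x) y
    simpa [smul_comm a (op b), tmulA] using this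

/-- The right action of `a` on `E ⊗_A E`. -/
def rActA (a : A) : TensorA A E →ₗ[ℂ] TensorA A E :=
  liftA ((balancedRel A E).mkQ ∘ₗ ((rAct A E).flip a).lTensor E) fun b x y => by
    have := tmulA_balanced b x (op a • y)
    simpa [smul_comm b (op a), tmulA] using this

@[simp] theorem lActA_tmulA (a : A) (x y : E) : lActA a (tmulA A x y) = tmulA A (a • x) y := by
  simp [lActA]; rfl

@[simp] theorem rActA_tmulA (a : A) (x y : E) :
    rActA a (tmulA A x y) = tmulA A x (op a • y) := by
  simp [rActA]; rfl

/-- The left coaction `m ⊗_A n ↦ m₍₋₁₎ n₍₋₁₎ ⊗ (m₍₀₎ ⊗_A n₍₀₎)` on `E ⊗_A E`. -/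
def ΔLA : TensorA A E →ₗ[ℂ] A ⊗[ℂ] TensorA A E :=
  liftA (map (LinearMap.mul' ℂ A) (balancedRel A E).mkQ ∘ₗ
    (tensorTensorTensorComm ℂ A E A E).toLinearMap ∘ₗ map C.ΔL C.ΔL) fun a x y => by
    simp only [LinearMap.comp_apply, map_tmul, ΔL_op_smul, ΔL_smul]
    generalize C.ΔL x = u
    generalize C.ΔL y = v
    generalize comul (R := ℂ) a = w
    induction u using TensorProduct.induction_on with
    | zero => simp
    | add s s' h h' => simp only [map_add, LinearMap.add_apply, add_tmul, h, h']
    | tmul b e =>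
    induction v using TensorProduct.induction_on with
    | zero => simp
    | add s s' h h' => simp only [map_add, tmul_add, h, h']
    | tmul c f =>
    induction w using TensorProduct.induction_on with
    | zero => simp
    | add s s' h h' => simp only [map_add, LinearMap.add_apply, tmul_add, add_tmul, h, h']
    | tmul a a' =>
      have := tmulA_balanced a' e f
      simp only [tmulA] at this
      simp [mul_assoc, this]

/-- The right coaction `m ⊗_A n ↦ (m₍₀₎ ⊗_A n₍₀₎) ⊗ m₍₁₎ n₍₁₎` on `E ⊗_A E`. -/
def ΔRA : TensorA A E →ₗ[ℂ] TensorA A E ⊗[ℂ] A :=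
  liftA (map (balancedRel A E).mkQ (LinearMap.mul' ℂ A) ∘ₗ
    (tensorTensorTensorComm ℂ E A E A).toLinearMap ∘ₗ map C.ΔR C.ΔR) fun a x y => by
    simp only [LinearMap.comp_apply, map_tmul, ΔR_op_smul, ΔR_smul]
    generalize C.ΔR x = u
    generalize C.ΔR y = v
    generalize comul (R := ℂ) a = w
    induction u using TensorProduct.induction_on with
    | zero => simp
    | add s s' h h' => simp only [map_add, LinearMap.add_apply, add_tmul, h, h']
    | tmul e b =>
    induction v using TensorProduct.induction_on with
    | zero => simp
    | add s s' h h' => simp only [map_add, tmul_add, h, h']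
    | tmul f c =>
    induction w using TensorProduct.induction_on with
    | zero => simp
    | add s s' h h' => simp only [map_add, LinearMap.add_apply, tmul_add, add_tmul, h, h']
    | tmul a a' =>
      have := tmulA_balanced a e f
      simp only [tmulA] at this
      simp [mul_assoc, this]

end Balanced

section Invariants

/-- The space of left-invariant one-forms. -/
def leftInv : Submodule ℂ E :=
  LinearMap.eqLocus C.ΔL (TensorProduct.mk ℂ A E 1)

/-- The space of right-invariant one-forms. -/
def rightInv : Submodule ℂ E :=
  LinearMap.eqLocus C.ΔR ((TensorProduct.mk ℂ E A).flip 1)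

/-- The space of left-invariant elements of `E ⊗_A E`. -/
def leftInvA : Submodule ℂ (TensorA A E) :=
  LinearMap.eqLocus C.ΔLA (TensorProduct.mk ℂ A (TensorA A E) 1)

theorem mem_leftInv {e : E} : e ∈ C.leftInv ↔ C.ΔL e = 1 ⊗ₜ e := Iff.rfl
theorem mem_rightInv {e : E} : e ∈ C.rightInv ↔ C.ΔR e = e ⊗ₜ 1 := Iff.rfl
theorem mem_leftInvA {x : TensorA A E} : x ∈ C.leftInvA ↔ C.ΔLA x = 1 ⊗ₜ x := Iff.rfl

end Invariants

section Braiding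

/-- `P(m) = S(m₍₋₁₎) m₍₀₎`, the projection onto the left-invariant forms. -/
def projL : E →ₗ[ℂ] E := lift (lAct A E) ∘ₗ (antipode ℂ).rTensor E ∘ₗ C.ΔL

/-- `P'(m) = m₍₀₎ S(m₍₁₎)`, the projection onto the right-invariant forms. -/
def projR : E →ₗ[ℂ] E := lift (rAct A E) ∘ₗ (antipode ℂ).lTensor E ∘ₗ C.ΔR

theorem projL_smul (a : A) (m : E) : C.projL (a • m) = counit (R := ℂ) a • C.projL m := by
  have h : ∀ (t : A ⊗[ℂ] A) (c : A) (e : E),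
      lift (lAct A E) ((antipode ℂ).rTensor E (lmulL A E t (c ⊗ₜ e))) =
      antipode ℂ c • LinearMap.mul' ℂ A ((antipode ℂ).rTensor A t) • e := by
    intro t c e
    induction t using TensorProduct.induction_on with
    | zero => simp
    | add s s' h h' => simp only [map_add, LinearMap.add_apply, add_smul, smul_add, h, h']
    | tmul a b => simp [antipode_mul_antidistrib, mul_smul]
  simp only [projL, LinearMap.comp_apply, ΔL_smul]
  generalize C.ΔL m = u
  induction u using TensorProduct.induction_on with
  | zero => simp
  | add s s' h h' => simp only [map_add, smul_add, h, h']
  | tmul b e =>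
    rw [h, mul_antipode_rTensor_comul_apply, algebraMap_smul, smul_comm]
    simp

theorem projR_op_smul (a : A) (m : E) :
    C.projR (op a • m) = counit (R := ℂ) a • C.projR m := by
  have h : ∀ (t : A ⊗[ℂ] A) (c : A) (e : E),
      lift (rAct A E) ((antipode ℂ).lTensor E (rmulR A E (e ⊗ₜ c) t)) =
      op (antipode ℂ c) • op (LinearMap.mul' ℂ A ((antipode ℂ).lTensor A t)) • e := by
    intro t c e
    induction t using TensorProduct.induction_on with
    | zero => simp
    | add s s' h h' => simp only [map_add, op_add, add_smul, smul_add, h, h']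
    | tmul a b => simp [antipode_mul_antidistrib, mul_smul]
  simp only [projR, LinearMap.comp_apply, ΔR_op_smul]
  generalize C.ΔR m = u
  induction u using TensorProduct.induction_on with
  | zero => simp
  | add s s' h h' => simp only [map_add, smul_add, LinearMap.add_apply, h, h']
  | tmul e b =>
    rw [h, mul_antipode_lTensor_comul_apply, ← MulOpposite.algebraMap_apply, algebraMap_smul,
      smul_comm]
    simp

variable (A) in
/-- `b ⊗ c ↦ S(b) y c`. -/
def conjL (y : E) : A ⊗[ℂ] A →ₗ[ℂ] E :=
  lift (LinearMap.mk₂ ℂ (fun b c : A => antipode ℂ b • op c • y) (by simp [add_smul])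
    (by simp) (by simp [add_smul]) (by intro c a b; simp [smul_comm _ c]))

variable (A) in
/-- `b ⊗ c ↦ b y S(c)`. -/
def conjR (y : E) : A ⊗[ℂ] A →ₗ[ℂ] E :=
  lift (LinearMap.mk₂ ℂ (fun b c : A => b • op (antipode ℂ c) • y) (by simp [add_smul])
    (by simp) (by simp [add_smul]) (by intro c a b; simp [smul_comm _ c]))

@[simp] theorem conjL_tmul (y : E) (b c : A) :
    conjL A y (b ⊗ₜ c) = antipode ℂ b • op c • y := rfl
@[simp] theorem conjR_tmul (y : E) (b c : A) :
    conjR A y (b ⊗ₜ c) = b • op (antipode ℂ c) • y := rfl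

theorem projL_op_smul (a : A) (m : E) :
    C.projL (op a • m) = conjL A (C.projL m) (comul a) := by
  simp only [projL, LinearMap.comp_apply, ΔL_op_smul]
  generalize C.ΔL m = u
  generalize comul (R := ℂ) a = t
  induction t using TensorProduct.induction_on with
  | zero => simp
  | add s s' h h' => simp only [map_add, h, h']
  | tmul a b =>
  induction u using TensorProduct.induction_on with
  | zero => simp
  | add s s' h h' =>
    simp only [map_add, LinearMap.add_apply, h, h', conjL_tmul, smul_add]
  | tmul c e => simp [antipode_mul_antidistrib, mul_smul, smul_comm _ (op b)]

theorem projR_smul (a : A) (m : E) :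
    C.projR (a • m) = conjR A (C.projR m) (comul a) := by
  simp only [projR, LinearMap.comp_apply, ΔR_smul]
  generalize C.ΔR m = u
  generalize comul (R := ℂ) a = t
  induction t using TensorProduct.induction_on with
  | zero => simp
  | add s s' h h' => simp only [map_add, LinearMap.add_apply, h, h']
  | tmul a b =>
  induction u using TensorProduct.induction_on with
  | zero => simp
  | add s s' h h' =>
    simp only [map_add, h, h', conjR_tmul, smul_add]
  | tmul e c => simp [antipode_mul_antidistrib, mul_smul, smul_comm a (_ : Aᵐᵒᵖ)]

/-- `m ↦ m₍₋₁₎ ⊗ P(m₍₀₎)`. -/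
def lam : E →ₗ[ℂ] A ⊗[ℂ] E := C.projL.lTensor A ∘ₗ C.ΔL

/-- `m ↦ P'(m₍₀₎) ⊗ m₍₁₎`. -/
def rho : E →ₗ[ℂ] E ⊗[ℂ] A := C.projR.rTensor A ∘ₗ C.ΔR

theorem lam_smul (a : A) (m : E) :
    C.lam (a • m) = (LinearMap.mul ℂ A a).rTensor E (C.lam m) := by
  have h : ∀ (t : A ⊗[ℂ] A) (c : A) (e : E), C.projL.lTensor A (lmulL A E t (c ⊗ₜ e)) =
      lift ((TensorProduct.mk ℂ A E).compl₁₂ ((LinearMap.mul ℂ A).flip c)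
        ((LinearMap.lsmul ℂ E).flip (C.projL e))) ((counit (R := ℂ) (A := A)).lTensor A t) := by
    intro t c e
    induction t using TensorProduct.induction_on with
    | zero => simp
    | add s s' h h' => simp only [map_add, LinearMap.add_apply, h, h']
    | tmul a b => simp [projL_smul]
  simp only [lam, LinearMap.comp_apply, ΔL_smul]
  generalize C.ΔL m = u
  induction u using TensorProduct.induction_on with
  | zero => simp
  | add s s' h h' => simp only [map_add, h, h']
  | tmul b e => simp [h]

theorem rho_op_smul (a : A) (m : E) :
    C.rho (op a • m) = ((LinearMap.mul ℂ A).flip a).lTensor E (C.rho m) := by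
  have h : ∀ (t : A ⊗[ℂ] A) (c : A) (e : E), C.projR.rTensor A (rmulR A E (e ⊗ₜ c) t) =
      lift ((TensorProduct.mk ℂ E A).compl₁₂ ((LinearMap.lsmul ℂ E).flip (C.projR e))
        (LinearMap.mul ℂ A c)) ((counit (R := ℂ) (A := A)).rTensor A t) := by
    intro t c e
    induction t using TensorProduct.induction_on with
    | zero => simp
    | add s s' h h' => simp only [map_add, h, h']
    | tmul a b => simp [projR_op_smul, smul_tmul']
  simp only [rho, LinearMap.comp_apply, ΔR_op_smul]
  generalize C.ΔR m = u
  induction u using TensorProduct.induction_on with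
  | zero => simp
  | add s s' h h' => simp only [map_add, LinearMap.add_apply, h, h']
  | tmul e b => simp [h]

variable (A E) in
/-- `(a ⊗ x) ⊗ (y ⊗ b) ↦ ay ⊗_A xb`. -/
def cross : (A ⊗[ℂ] E) ⊗[ℂ] (E ⊗[ℂ] A) →ₗ[ℂ] TensorA A E :=
  (balancedRel A E).mkQ ∘ₗ map (lift (lAct A E)) (lift (rAct A E)) ∘ₗ
    (tensorTensorTensorComm ℂ A E E A).toLinearMap

@[simp] theorem cross_tmul (a b : A) (x y : E) :
    cross A E ((a ⊗ₜ x) ⊗ₜ (y ⊗ₜ b)) = tmulA A (a • y) (op b • x) := rfl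

/-- `a ⊗ (b ⊗ c) ↦ c₀ a y ⊗_A S(b) x c g`. -/
def mid (c₀ g : A) (x y : E) : A ⊗[ℂ] (A ⊗[ℂ] A) →ₗ[ℂ] TensorA A E :=
  (balancedRel A E).mkQ ∘ₗ map ((rAct' y) ∘ₗ LinearMap.mul ℂ A c₀)
    ((rAct A E).flip g ∘ₗ conjL A x)
 where rAct' (y : E) : A →ₗ[ℂ] E := (lAct A E).flip y

theorem mid_tmul (c₀ g : A) (x y : E) (a b c : A) : mid c₀ g x y (a ⊗ₜ (b ⊗ₜ c)) =
    tmulA A ((c₀ * a) • y) (op g • antipode ℂ b • op c • x) := rfl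

theorem braiding_aux (a : A) (m n : E) : cross A E (map C.lam C.rho ((op a • m) ⊗ₜ n)) =
    cross A E (map C.lam C.rho (m ⊗ₜ (a • n))) := by
  have h₁ : ∀ (t : A ⊗[ℂ] A) (c₀ g : A) (x y : E), cross A E
      (C.projL.lTensor A (rmulL A E (c₀ ⊗ₜ x) t) ⊗ₜ C.projR.rTensor A (y ⊗ₜ g)) =
      mid c₀ g (C.projL x) (C.projR y) (comul.lTensor A t) := by
    intro t c₀ g x y
    induction t using TensorProduct.induction_on with
    | zero => simp
    | add s s' h h' => simp only [map_add, add_tmul, h, h']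
    | tmul a b =>
      simp only [rmulL_tmul, LinearMap.lTensor_tmul, projL_op_smul, LinearMap.rTensor_tmul,
        cross_tmul]
      generalize comul (R := ℂ) b = u
      induction u using TensorProduct.induction_on with
      | zero => simp [tmulA]
      | add s s' h h' =>
        simp only [map_add, tmul_add, smul_add, ← h, ← h']
        simp [tmulA, tmul_add]
      | tmul b c => simp [mid_tmul]
  have h₂ : ∀ (t : A ⊗[ℂ] A) (c₀ g : A) (x y : E), cross A E
      (C.projL.lTensor A (c₀ ⊗ₜ x) ⊗ₜ C.projR.rTensor A (lmulR A E t (y ⊗ₜ g))) =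
      mid c₀ g (C.projL x) (C.projR y) (TensorProduct.assoc ℂ A A A (comul.rTensor A t)) := by
    intro t c₀ g x y
    induction t using TensorProduct.induction_on with
    | zero => simp
    | add s s' h h' => simp only [map_add, tmul_add, LinearMap.add_apply, h, h']
    | tmul a b =>
      simp only [lmulR_tmul, LinearMap.lTensor_tmul, projR_smul, LinearMap.rTensor_tmul,
        cross_tmul]
      generalize comul (R := ℂ) a = u
      induction u using TensorProduct.induction_on with
      | zero => simp [tmulA]
      | add s s' h h' =>
        simp only [map_add, add_tmul, smul_add, ← h, ← h']
        simp [tmulA, add_tmul]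
      | tmul a c =>
        simp only [assoc_tmul, mid_tmul, conjR_tmul]
        rw [smul_comm a, smul_comm c₀, tmulA_balanced, mul_smul, op_mul, mul_smul,
          smul_comm (antipode ℂ c) (op g), smul_comm (antipode ℂ c) (op b)]
  simp only [map_tmul, lam, rho, LinearMap.comp_apply, ΔL_op_smul, ΔR_smul]
  generalize C.ΔL m = u
  generalize C.ΔR n = v
  induction u using TensorProduct.induction_on with
  | zero => simp
  | add s s' h h' => simp only [map_add, LinearMap.add_apply, add_tmul, h, h']
  | tmul b e =>
  induction v using TensorProduct.induction_on with
  | zero => simp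
  | add s s' h h' => simp only [map_add, tmul_add, h, h']
  | tmul c f => rw [h₁, h₂, coassoc_apply]

/-- The canonical braiding `σ` of `E ⊗_A E`, `m ⊗_A n ↦ m₍₋₁₎ P'(n₍₀₎) ⊗_A P(m₍₀₎) n₍₁₎`. It is a
bimodule map (`braiding_lActA`, `braiding_rActA`) with `σ (ω ⊗_A η) = η ⊗_A ω` for left-invariant
`ω` and right-invariant `η` (`braiding_flip`), and the only one (`braiding_unique`). -/
def braiding : TensorA A E →ₗ[ℂ] TensorA A E :=
  liftA (cross A E ∘ₗ map C.lam C.rho) C.braiding_aux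

end Braiding

section BraidingProperties

theorem braiding_tmulA (m n : E) :
    C.braiding (tmulA A m n) = cross A E (C.lam m ⊗ₜ C.rho n) := by
  simp [braiding]

theorem braiding_lActA (a : A) (x : TensorA A E) :
    C.braiding (lActA a x) = lActA a (C.braiding x) := by
  suffices C.braiding ∘ₗ lActA a = lActA a ∘ₗ C.braiding from LinearMap.congr_fun this x
  refine ext_tmulA fun m n => ?_
  simp only [LinearMap.comp_apply, lActA_tmulA, braiding_tmulA, lam_smul]
  generalize C.lam m = u
  generalize C.rho n = v
  induction u using TensorProduct.induction_on with
  | zero => simp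
  | add s s' h h' => simp only [map_add, add_tmul, h, h']
  | tmul b e =>
  induction v using TensorProduct.induction_on with
  | zero => simp
  | add s s' h h' => simp only [map_add, tmul_add, h, h']
  | tmul c f => simp [mul_smul]

theorem braiding_rActA (a : A) (x : TensorA A E) :
    C.braiding (rActA a x) = rActA a (C.braiding x) := by
  suffices C.braiding ∘ₗ rActA a = rActA a ∘ₗ C.braiding from LinearMap.congr_fun this x
  refine ext_tmulA fun m n => ?_
  simp only [LinearMap.comp_apply, rActA_tmulA, braiding_tmulA, rho_op_smul]
  generalize C.lam m = u
  generalize C.rho n = v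
  induction u using TensorProduct.induction_on with
  | zero => simp
  | add s s' h h' => simp only [map_add, add_tmul, h, h']
  | tmul b e =>
  induction v using TensorProduct.induction_on with
  | zero => simp
  | add s s' h h' => simp only [map_add, tmul_add, h, h']
  | tmul c f => simp [mul_smul]

theorem projL_of_mem {ω : E} (h : ω ∈ C.leftInv) : C.projL ω = ω := by
  simp [projL, C.mem_leftInv.1 h]

theorem projR_of_mem {η : E} (h : η ∈ C.rightInv) : C.projR η = η := by
  simp [projR, C.mem_rightInv.1 h]

theorem lam_of_mem {ω : E} (h : ω ∈ C.leftInv) : C.lam ω = 1 ⊗ₜ ω := by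
  simp [lam, C.mem_leftInv.1 h, C.projL_of_mem h]

theorem rho_of_mem {η : E} (h : η ∈ C.rightInv) : C.rho η = η ⊗ₜ 1 := by
  simp [rho, C.mem_rightInv.1 h, C.projR_of_mem h]

theorem braiding_flip {ω η : E} (hω : ω ∈ C.leftInv) (hη : η ∈ C.rightInv) :
    C.braiding (tmulA A ω η) = tmulA A η ω := by
  simp [braiding_tmulA, C.lam_of_mem hω, C.rho_of_mem hη]

theorem lam_reconstruct (m : E) : lift (lAct A E) (C.lam m) = m := by
  have h₁ : ∀ x : A ⊗[ℂ] E, lift (lAct A E) (C.projL.lTensor A x) =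
      lift ((lAct A E).compl₂ (lift (lAct A E) ∘ₗ (antipode ℂ).rTensor E))
        (C.ΔL.lTensor A x) := by
    intro x
    induction x using TensorProduct.induction_on with
    | zero => simp
    | add s s' h h' => simp only [map_add, h, h']
    | tmul c e => simp [projL]
  have h₂ : ∀ x : A ⊗[ℂ] E, lift ((lAct A E).compl₂ (lift (lAct A E) ∘ₗ
      (antipode ℂ).rTensor E)) (TensorProduct.assoc ℂ A A E (comul.rTensor E x)) =
      TensorProduct.lid ℂ E ((counit (R := ℂ) (A := A)).rTensor E x) := by
    intro x
    induction x using TensorProduct.induction_on with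
    | zero => simp
    | add s s' h h' => simp only [map_add, h, h']
    | tmul c e =>
      have h₃ : ∀ t : A ⊗[ℂ] A, lift ((lAct A E).compl₂ (lift (lAct A E) ∘ₗ
          (antipode ℂ).rTensor E)) (TensorProduct.assoc ℂ A A E (t ⊗ₜ e)) =
          LinearMap.mul' ℂ A ((antipode ℂ).lTensor A t) • e := by
        intro t
        induction t using TensorProduct.induction_on with
        | zero => simp
        | add s s' h h' => simp only [map_add, add_tmul, add_smul, h, h']
        | tmul a b => simp [mul_smul]
      rw [LinearMap.rTensor_tmul, h₃, mul_antipode_lTensor_comul_apply]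
      simp
  rw [lam, LinearMap.comp_apply, h₁, ← coassoc_ΔL, h₂, counit_ΔL]

theorem rho_reconstruct (m : E) : lift (rAct A E) (C.rho m) = m := by
  have h₁ : ∀ x : E ⊗[ℂ] A, lift (rAct A E) (C.projR.rTensor A x) =
      lift ((rAct A E).comp (lift (rAct A E) ∘ₗ (antipode ℂ).lTensor E))
        (C.ΔR.rTensor A x) := by
    intro x
    induction x using TensorProduct.induction_on with
    | zero => simp
    | add s s' h h' => simp only [map_add, h, h']
    | tmul c e => simp [projR]
  have h₂ : ∀ x : E ⊗[ℂ] A, lift ((rAct A E).comp (lift (rAct A E) ∘ₗ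
      (antipode ℂ).lTensor E)) ((TensorProduct.assoc ℂ E A A).symm (comul.lTensor E x)) =
      TensorProduct.rid ℂ E ((counit (R := ℂ) (A := A)).lTensor E x) := by
    intro x
    induction x using TensorProduct.induction_on with
    | zero => simp
    | add s s' h h' => simp only [map_add, h, h']
    | tmul e c =>
      have h₃ : ∀ t : A ⊗[ℂ] A, lift ((rAct A E).comp (lift (rAct A E) ∘ₗ
          (antipode ℂ).lTensor E)) ((TensorProduct.assoc ℂ E A A).symm (e ⊗ₜ t)) =
          op (LinearMap.mul' ℂ A ((antipode ℂ).rTensor A t)) • e := by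
        intro t
        induction t using TensorProduct.induction_on with
        | zero => simp
        | add s s' h h' => simp only [map_add, tmul_add, op_add, add_smul, h, h']
        | tmul a b => simp [mul_smul]
      rw [LinearMap.lTensor_tmul, h₃, mul_antipode_rTensor_comul_apply,
        ← MulOpposite.algebraMap_apply, algebraMap_smul]
      simp
  rw [rho, LinearMap.comp_apply, h₁, ← LinearEquiv.symm_apply_apply
    (TensorProduct.assoc ℂ E A A) (C.ΔR.rTensor A (C.ΔR m)), coassoc_ΔR, h₂, counit_ΔR]

theorem ΔL_eq (m : E) : C.ΔL m =
    lift ((lmulL A E).compl₁₂ comul (TensorProduct.mk ℂ A E 1)) (C.lam m) := by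
  have h₁ : ∀ x : A ⊗[ℂ] E, x =
      (lift (lAct A E)).lTensor A ((C.projL.lTensor A).lTensor A (C.ΔL.lTensor A x)) := by
    intro x
    induction x using TensorProduct.induction_on with
    | zero => simp
    | add s s' h h' => simp only [map_add, ← h, ← h']
    | tmul c e =>
      have := C.lam_reconstruct e
      simp only [lam, LinearMap.comp_apply] at this
      simp [this]
  have h₂ : ∀ x : A ⊗[ℂ] E, (lift (lAct A E)).lTensor A ((C.projL.lTensor A).lTensor A
      (TensorProduct.assoc ℂ A A E (comul.rTensor E x))) =
      lift ((lmulL A E).compl₁₂ comul (TensorProduct.mk ℂ A E 1)) (C.projL.lTensor A x) := by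
    intro x
    induction x using TensorProduct.induction_on with
    | zero => simp
    | add s s' h h' => simp only [map_add, h, h']
    | tmul c e =>
      simp only [LinearMap.rTensor_tmul, LinearMap.lTensor_tmul, lift.tmul,
        LinearMap.compl₁₂_apply, TensorProduct.mk_apply]
      generalize comul (R := ℂ) c = t
      induction t using TensorProduct.induction_on with
      | zero => simp
      | add s s' h h' => simp only [map_add, LinearMap.add_apply, add_tmul, h, h']
      | tmul a b => simp
  conv_lhs => rw [h₁ (C.ΔL m), ← coassoc_ΔL, h₂]
  rfl

theorem ΔR_eq (m : E) : C.ΔR m =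
    lift ((rmulR A E).compl₁₂ ((TensorProduct.mk ℂ E A).flip 1) comul) (C.rho m) := by
  have h₁ : ∀ x : E ⊗[ℂ] A, x =
      (lift (rAct A E)).rTensor A ((C.projR.rTensor A).rTensor A (C.ΔR.rTensor A x)) := by
    intro x
    induction x using TensorProduct.induction_on with
    | zero => simp
    | add s s' h h' => simp only [map_add, ← h, ← h']
    | tmul e c =>
      have := C.rho_reconstruct e
      simp only [rho, LinearMap.comp_apply] at this
      simp [this]
  have h₂ : ∀ x : E ⊗[ℂ] A, (lift (rAct A E)).rTensor A ((C.projR.rTensor A).rTensor A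
      ((TensorProduct.assoc ℂ E A A).symm (comul.lTensor E x))) =
      lift ((rmulR A E).compl₁₂ ((TensorProduct.mk ℂ E A).flip 1) comul)
        (C.projR.rTensor A x) := by
    intro x
    induction x using TensorProduct.induction_on with
    | zero => simp
    | add s s' h h' => simp only [map_add, h, h']
    | tmul e c =>
      simp only [LinearMap.rTensor_tmul, LinearMap.lTensor_tmul, lift.tmul,
        LinearMap.compl₁₂_apply, TensorProduct.mk_apply, LinearMap.flip_apply]
      generalize comul (R := ℂ) c = t
      induction t using TensorProduct.induction_on with
      | zero => simp
      | add s s' h h' => simp only [map_add, tmul_add, h, h']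
      | tmul a b => simp
  conv_lhs => rw [h₁ (C.ΔR m), ← LinearEquiv.symm_apply_apply
    (TensorProduct.assoc ℂ E A A) (C.ΔR.rTensor A (C.ΔR m)), coassoc_ΔR, h₂]
  rfl

theorem projL_mem (m : E) : C.projL m ∈ C.leftInv := by
  let H : A →ₗ[ℂ] E →ₗ[ℂ] A ⊗[ℂ] E :=
    (lmulL A E).compl₁₂ comul (TensorProduct.mk ℂ A E 1 ∘ₗ C.projL)
  let K : A ⊗[ℂ] (A ⊗[ℂ] E) →ₗ[ℂ] A ⊗[ℂ] E :=
    lift H ∘ₗ (LinearMap.mul' ℂ A ∘ₗ (antipode ℂ).rTensor A).rTensor E ∘ₗ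
      (TensorProduct.assoc ℂ A A E).symm.toLinearMap
  have h₁ : ∀ x : A ⊗[ℂ] E, C.ΔL (lift (lAct A E) ((antipode ℂ).rTensor E x)) =
      K (C.ΔL.lTensor A x) := by
    intro x
    induction x using TensorProduct.induction_on with
    | zero => simp
    | add s s' h h' => simp only [map_add, h, h']
    | tmul c e =>
      simp only [LinearMap.rTensor_tmul, lift.tmul, lAct_apply, ΔL_smul, LinearMap.lTensor_tmul]
      conv_lhs => rw [ΔL_eq, lam, LinearMap.comp_apply]
      generalize C.ΔL e = u
      induction u using TensorProduct.induction_on with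
      | zero => simp
      | add s s' h h' => simp only [map_add, tmul_add, h, h']
      | tmul b f => simp [K, H, lmulL_mul]
  have h₂ : ∀ x : A ⊗[ℂ] E, K (TensorProduct.assoc ℂ A A E (comul.rTensor E x)) =
      1 ⊗ₜ C.projL (TensorProduct.lid ℂ E ((counit (R := ℂ) (A := A)).rTensor E x)) := by
    intro x
    induction x using TensorProduct.induction_on with
    | zero => simp
    | add s s' h h' => simp only [map_add, tmul_add, h, h']
    | tmul c e =>
      simp [K, H, Algebra.algebraMap_eq_smul_one, lmulL_one]
  rw [mem_leftInv]
  conv_lhs => rw [projL, LinearMap.comp_apply, LinearMap.comp_apply, h₁, ← coassoc_ΔL, h₂,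
    counit_ΔL]

theorem rmulR_mul (s t : A ⊗[ℂ] A) (x : E ⊗[ℂ] A) :
    rmulR A E x (s * t) = rmulR A E (rmulR A E x s) t := by
  induction s using TensorProduct.induction_on with
  | zero => simp
  | add s s' h h' => simp [add_mul, h, h']
  | tmul a b =>
  induction t using TensorProduct.induction_on with
  | zero => simp
  | add s s' h h' => simp [mul_add, h, h']
  | tmul a' b' =>
  induction x using TensorProduct.induction_on with
  | zero => simp
  | add s s' h h' => simp only [map_add, LinearMap.add_apply, h, h']
  | tmul c e => simp [mul_assoc, mul_smul]

theorem rmulR_one (x : E ⊗[ℂ] A) : rmulR A E x 1 = x := by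
  induction x using TensorProduct.induction_on with
  | zero => simp
  | add s s' h h' => simp only [map_add, LinearMap.add_apply, h, h']
  | tmul c e => simp [Algebra.TensorProduct.one_def]

theorem projR_mem (m : E) : C.projR m ∈ C.rightInv := by
  let H : E →ₗ[ℂ] A →ₗ[ℂ] E ⊗[ℂ] A :=
    (rmulR A E).compl₁₂ ((TensorProduct.mk ℂ E A).flip 1 ∘ₗ C.projR) comul
  let K : (E ⊗[ℂ] A) ⊗[ℂ] A →ₗ[ℂ] E ⊗[ℂ] A :=
    lift H ∘ₗ (LinearMap.mul' ℂ A ∘ₗ (antipode ℂ).lTensor A).lTensor E ∘ₗ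
      (TensorProduct.assoc ℂ E A A).toLinearMap
  have h₁ : ∀ x : E ⊗[ℂ] A, C.ΔR (lift (rAct A E) ((antipode ℂ).lTensor E x)) =
      K (C.ΔR.rTensor A x) := by
    intro x
    induction x using TensorProduct.induction_on with
    | zero => simp
    | add s s' h h' => simp only [map_add, h, h']
    | tmul e c =>
      simp only [LinearMap.rTensor_tmul, lift.tmul, rAct_apply, ΔR_op_smul,
        LinearMap.lTensor_tmul]
      conv_lhs => rw [ΔR_eq, rho, LinearMap.comp_apply]
      generalize C.ΔR e = u
      induction u using TensorProduct.induction_on with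
      | zero => simp
      | add s s' h h' => simp only [map_add, LinearMap.add_apply, add_tmul, h, h']
      | tmul b f => simp [K, H, rmulR_mul]
  have h₂ : ∀ x : E ⊗[ℂ] A, K ((TensorProduct.assoc ℂ E A A).symm (comul.lTensor E x)) =
      C.projR (TensorProduct.rid ℂ E ((counit (R := ℂ) (A := A)).lTensor E x)) ⊗ₜ 1 := by
    intro x
    induction x using TensorProduct.induction_on with
    | zero => simp
    | add s s' h h' => simp only [map_add, add_tmul, h, h']
    | tmul e c =>
      simp [K, H, Algebra.algebraMap_eq_smul_one, rmulR_one, smul_tmul']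
  rw [mem_rightInv]
  conv_lhs => rw [projR, LinearMap.comp_apply, LinearMap.comp_apply, h₁,
    ← LinearEquiv.symm_apply_apply (TensorProduct.assoc ℂ E A A) (C.ΔR.rTensor A (C.ΔR m)),
    coassoc_ΔR, h₂, counit_ΔR]

/-- `E ⊗_A E` is spanned by the elements `aω ⊗_A ηb`, `ω` left-invariant, `η` right-invariant. -/
theorem ext_inv {V : Type*} [AddCommGroup V] [Module ℂ V] {f g : TensorA A E →ₗ[ℂ] V}
    (h : ∀ (a b : A) (ω η : E), ω ∈ C.leftInv → η ∈ C.rightInv →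
      f (tmulA A (a • ω) (op b • η)) = g (tmulA A (a • ω) (op b • η))) : f = g := by
  refine ext_tmulA fun m n => ?_
  rw [← C.lam_reconstruct m, ← C.rho_reconstruct n, lam, rho, LinearMap.comp_apply,
    LinearMap.comp_apply]
  generalize C.ΔL m = u
  generalize C.ΔR n = v
  induction u using TensorProduct.induction_on with
  | zero => simp [tmulA]
  | add s s' h h' => simpa [tmulA, add_tmul] using congrArg₂ (· + ·) h h'
  | tmul b e =>
  induction v using TensorProduct.induction_on with
  | zero => simp [tmulA]
  | add s s' h h' => simpa [tmulA, tmul_add] using congrArg₂ (· + ·) h h'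
  | tmul f c => simpa using h b c _ _ (C.projL_mem e) (C.projR_mem f)

/-- The braiding is the only bimodule map that sends `ω ⊗_A η` to `η ⊗_A ω` for left-invariant `ω`
and right-invariant `η`. -/
theorem braiding_unique (τ : TensorA A E →ₗ[ℂ] TensorA A E)
    (hl : ∀ a x, τ (lActA a x) = lActA a (τ x)) (hr : ∀ a x, τ (rActA a x) = rActA a (τ x))
    (hτ : ∀ ω ∈ C.leftInv, ∀ η ∈ C.rightInv, τ (tmulA A ω η) = tmulA A η ω) :
    τ = C.braiding := by
  refine C.ext_inv fun a b ω η hω hη => ?_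
  rw [← rActA_tmulA, ← lActA_tmulA, hr, hl, hτ ω hω η hη, braiding_rActA, braiding_lActA,
    C.braiding_flip hω hη]

theorem ΔLA_tmulA (m n : E) : C.ΔLA (tmulA A m n) =
    map (LinearMap.mul' ℂ A) (balancedRel A E).mkQ
      (tensorTensorTensorComm ℂ A E A E (C.ΔL m ⊗ₜ C.ΔL n)) := by
  simp [ΔLA]

theorem ΔRA_tmulA (m n : E) : C.ΔRA (tmulA A m n) =
    map (balancedRel A E).mkQ (LinearMap.mul' ℂ A)
      (tensorTensorTensorComm ℂ E A E A (C.ΔR m ⊗ₜ C.ΔR n)) := by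
  simp [ΔRA]

theorem rho_lTensor_ΔL {η : E} (hη : η ∈ C.rightInv) : C.rho.lTensor A (C.ΔL η) =
    ((TensorProduct.mk ℂ E A).flip 1).lTensor A (C.ΔL η) := by
  have h₀ : C.ΔR.lTensor A (C.ΔL η) =
      ((TensorProduct.mk ℂ E A).flip 1).lTensor A (C.ΔL η) := by
    rw [← ΔL_ΔR, C.mem_rightInv.1 hη, LinearMap.rTensor_tmul]
    generalize C.ΔL η = u
    induction u using TensorProduct.induction_on with
    | zero => simp
    | add s s' h h' => simp only [map_add, add_tmul, h, h']
    | tmul b e => simp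
  have h₁ : C.projR.lTensor A (C.ΔL η) = C.ΔL η := by
    rw [projR, ← LinearMap.comp_assoc, LinearMap.lTensor_comp, LinearMap.comp_apply, h₀]
    generalize C.ΔL η = u
    induction u using TensorProduct.induction_on with
    | zero => simp
    | add s s' h h' => simp only [map_add, h, h']
    | tmul b e => simp
  rw [rho, LinearMap.lTensor_comp, LinearMap.comp_apply, h₀]
  conv_rhs => rw [← h₁]
  generalize C.ΔL η = u
  induction u using TensorProduct.induction_on with
  | zero => simp
  | add s s' h h' => simp only [map_add, h, h']
  | tmul b e => simp

theorem braiding_leftCovariant (x : TensorA A E) :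
    C.ΔLA (C.braiding x) = C.braiding.lTensor A (C.ΔLA x) := by
  suffices C.ΔLA ∘ₗ C.braiding = C.braiding.lTensor A ∘ₗ C.ΔLA from LinearMap.congr_fun this x
  refine C.ext_inv fun a b ω η hω hη => ?_
  have hr := C.rho_lTensor_ΔL hη
  have hσ : C.braiding (tmulA A (a • ω) (op b • η)) = tmulA A (a • η) (op b • ω) := by
    rw [← rActA_tmulA, ← lActA_tmulA, braiding_rActA, braiding_lActA, C.braiding_flip hω hη]
    simp
  simp only [LinearMap.comp_apply, hσ, ΔLA_tmulA, ΔL_smul, ΔL_op_smul, C.mem_leftInv.1 hω]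
  generalize C.ΔL η = u at hr
  generalize comul (R := ℂ) a = s
  generalize comul (R := ℂ) b = t
  induction s using TensorProduct.induction_on with
  | zero => simp
  | add s s' h h' => simp only [map_add, LinearMap.add_apply, add_tmul, h, h']
  | tmul a₁ a₂ =>
  induction t using TensorProduct.induction_on with
  | zero => simp
  | add s s' h h' => simp only [map_add, tmul_add, h, h']
  | tmul b₁ b₂ =>
  let Z : A ⊗[ℂ] (E ⊗[ℂ] A) →ₗ[ℂ] A ⊗[ℂ] TensorA A E :=
    map ((LinearMap.mul ℂ A).flip b₁ ∘ₗ LinearMap.mul ℂ A a₁)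
      (rActA b₂ ∘ₗ cross A E ∘ₗ TensorProduct.mk ℂ (A ⊗[ℂ] E) (E ⊗[ℂ] A) (a₂ ⊗ₜ ω))
  have hl : ∀ u : A ⊗[ℂ] E, map (LinearMap.mul' ℂ A) (balancedRel A E).mkQ
      (tensorTensorTensorComm ℂ A E A E (lmulL A E (a₁ ⊗ₜ a₂) u ⊗ₜ
        rmulL A E (1 ⊗ₜ ω) (b₁ ⊗ₜ b₂))) =
      Z (((TensorProduct.mk ℂ E A).flip 1).lTensor A u) := by
    intro u
    induction u using TensorProduct.induction_on with
    | zero => simp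
    | add s s' h h' => simp only [map_add, add_tmul, h, h']
    | tmul c e => simp [Z, mul_assoc]; rfl
  have hl' : ∀ u : A ⊗[ℂ] E, C.braiding.lTensor A (map (LinearMap.mul' ℂ A)
      (balancedRel A E).mkQ (tensorTensorTensorComm ℂ A E A E
        (lmulL A E (a₁ ⊗ₜ a₂) (1 ⊗ₜ ω) ⊗ₜ rmulL A E u (b₁ ⊗ₜ b₂)))) =
      Z (C.rho.lTensor A u) := by
    intro u
    induction u using TensorProduct.induction_on with
    | zero => simp
    | add s s' h h' => simp only [map_add, LinearMap.add_apply, tmul_add, h, h']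
    | tmul c e =>
      have : C.braiding (tmulA A (a₂ • ω) (op b₂ • e)) =
          rActA b₂ (cross A E ((a₂ ⊗ₜ ω) ⊗ₜ C.rho e)) := by
        rw [← rActA_tmulA, braiding_rActA, braiding_tmulA, lam_smul, C.lam_of_mem hω]
        simp
      rw [tmulA] at this
      simp [Z, mul_assoc]
      rw [← this]
      rfl
  rw [hl, hl', hr]

theorem braiding_mem {x : TensorA A E} (hx : x ∈ C.leftInvA) : C.braiding x ∈ C.leftInvA := by
  rw [mem_leftInvA, braiding_leftCovariant, C.mem_leftInvA.1 hx, LinearMap.lTensor_tmul]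

/-- The restriction of the braiding to the left-invariant elements of `E ⊗_A E`. -/
def braiding₀ : Module.End ℂ C.leftInvA := C.braiding.restrict fun _ => C.braiding_mem

end BraidingProperties

section TwoForms

/-- The bimodule of two-forms `(E ⊗_A E) / Ker (σ - 1)`. -/
abbrev TwoForms : Type _ := TensorA A E ⧸ LinearMap.ker (C.braiding - LinearMap.id)

/-- The quotient map `∧ : E ⊗_A E → Ω²(A)`. -/
def wedge : TensorA A E →ₗ[ℂ] C.TwoForms := (LinearMap.ker (C.braiding - LinearMap.id)).mkQ

theorem lam_d (a : A) : C.lam (C.d a) = (C.projL ∘ₗ C.d).lTensor A (comul a) := by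
  rw [lam, LinearMap.comp_apply, ΔL_d, LinearMap.lTensor_comp, LinearMap.comp_apply]

theorem rho_d (a : A) : C.rho (C.d a) = (C.projR ∘ₗ C.d).rTensor A (comul a) := by
  rw [rho, LinearMap.comp_apply, ΔR_d, LinearMap.rTensor_comp, LinearMap.comp_apply]

/-- `b ⊗ (c ⊗ e) ↦ a₁ db ⊗_A S(c) x e`. -/
def midD (a₁ : A) (x : E) : A ⊗[ℂ] (A ⊗[ℂ] A) →ₗ[ℂ] TensorA A E :=
  (balancedRel A E).mkQ ∘ₗ map (lAct A E a₁ ∘ₗ C.d) (conjL A x)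

theorem midD_tmul (a₁ : A) (x : E) (b c e : A) : C.midD a₁ x (b ⊗ₜ (c ⊗ₜ e)) =
    tmulA A (a₁ • C.d b) (antipode ℂ c • op e • x) := rfl

theorem braiding_d_aux₁ (a b : A) :
    (balancedRel A E).mkQ ((C.projL ∘ₗ C.d).lTensor E (C.ΔR (a • C.d b))) =
      C.braiding (tmulA A (C.d a) (C.d b)) +
        (balancedRel A E).mkQ (map (lAct A E a ∘ₗ C.d) (C.projL ∘ₗ C.d) (comul b)) := by
  have h₁ : ∀ (a₁ a₂ : A) (t : A ⊗[ℂ] A), (balancedRel A E).mkQ ((C.projL ∘ₗ C.d).lTensor E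
      (lmulR A E (a₁ ⊗ₜ a₂) (C.d.rTensor A t))) =
      C.midD a₁ (C.projL (C.d a₂)) (comul.lTensor A t) + counit (R := ℂ) a₂ •
        (balancedRel A E).mkQ (map (lAct A E a₁ ∘ₗ C.d) (C.projL ∘ₗ C.d) t) := by
    intro a₁ a₂ t
    induction t using TensorProduct.induction_on with
    | zero => simp
    | add s s' h h' => simp only [map_add, h, h', smul_add]; abel
    | tmul b c =>
      simp only [LinearMap.rTensor_tmul, LinearMap.lTensor_tmul, lmulR_tmul, LinearMap.comp_apply,
        C.leibniz, map_add, projL_op_smul, projL_smul, map_tmul, tmul_add, tmul_smul, map_smul]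
      rfl
  have h₂ : ∀ (a₁ a₂ : A) (t : A ⊗[ℂ] A), cross A E ((a₁ ⊗ₜ C.projL (C.d a₂)) ⊗ₜ
      ((C.projR ∘ₗ C.d).rTensor A t)) = C.midD a₁ (C.projL (C.d a₂))
        (TensorProduct.assoc ℂ A A A (comul.rTensor A t)) := by
    intro a₁ a₂ t
    induction t using TensorProduct.induction_on with
    | zero => simp
    | add s s' h h' => simp only [map_add, tmul_add, h, h']
    | tmul b c =>
      simp only [LinearMap.rTensor_tmul, LinearMap.comp_apply, cross_tmul, projR, ΔR_d]
      generalize comul (R := ℂ) b = u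
      induction u using TensorProduct.induction_on with
      | zero => simp [tmulA]
      | add s s' h h' =>
        simp only [map_add, add_tmul, smul_add, ← h, ← h']
        simp [tmulA, add_tmul]
      | tmul b b' =>
        simp only [LinearMap.rTensor_tmul, LinearMap.lTensor_tmul, lift.tmul, rAct_apply,
          assoc_tmul, midD_tmul]
        rw [smul_comm a₁ (op (antipode ℂ b')), tmulA_balanced]
  have h₃ : ∀ s : A ⊗[ℂ] A, (balancedRel A E).mkQ ((C.projL ∘ₗ C.d).lTensor E
      (lmulR A E s (C.d.rTensor A (comul b)))) =
      cross A E ((C.projL ∘ₗ C.d).lTensor A s ⊗ₜ ((C.projR ∘ₗ C.d).rTensor A (comul b))) +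
      (balancedRel A E).mkQ (map (lAct A E (TensorProduct.rid ℂ A
        ((counit (R := ℂ)).lTensor A s)) ∘ₗ C.d) (C.projL ∘ₗ C.d) (comul b)) := by
    intro s
    induction s using TensorProduct.induction_on with
    | zero => simp
    | add s s' h h' =>
      simp only [map_add, LinearMap.add_apply, LinearMap.add_comp, map_add_left, add_tmul, h, h']
      abel
    | tmul a₁ a₂ =>
      rw [h₁, LinearMap.lTensor_tmul, LinearMap.comp_apply, h₂, coassoc_apply]
      simp [LinearMap.smul_comp, map_smul_left]
  rw [ΔR_form, h₃, braiding_tmulA, lam_d, rho_d]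
  simp

theorem braiding_d_aux₂ (a b : A) :
    (balancedRel A E).mkQ ((C.d.rTensor E) (C.lam (a • C.d b))) = tmulA A (C.d a) (C.d b) +
      (balancedRel A E).mkQ (map (lAct A E a ∘ₗ C.d) (C.projL ∘ₗ C.d) (comul b)) := by
  have hb : tmulA A (C.d a) (C.d b) = tmulA A (C.d a) (lift (lAct A E) (C.lam (C.d b))) := by
    rw [lam_reconstruct]
  rw [hb, lam_smul, lam_d]
  generalize comul (R := ℂ) b = t
  induction t using TensorProduct.induction_on with
  | zero => simp [tmulA]
  | add s s' h h' =>
    simp only [map_add, h, h']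
    simp only [tmulA, tmul_add, map_add]
    abel
  | tmul b c =>
    simp only [LinearMap.lTensor_tmul, LinearMap.rTensor_tmul, LinearMap.comp_apply,
      LinearMap.mul_apply', C.leibniz, add_tmul, map_add, lift.tmul, lAct_apply, map_tmul,
      ← tmulA_balanced]
    rfl

theorem dForm_aux : LinearMap.ker C.form ≤ LinearMap.ker
    (C.wedge ∘ₗ (balancedRel A E).mkQ ∘ₗ map C.d C.d) := by
  have key : (C.braiding - LinearMap.id) ∘ₗ (balancedRel A E).mkQ ∘ₗ map C.d C.d =
      ((balancedRel A E).mkQ ∘ₗ (C.projL ∘ₗ C.d).lTensor E ∘ₗ C.ΔR -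
        (balancedRel A E).mkQ ∘ₗ C.d.rTensor E ∘ₗ C.lam) ∘ₗ C.form := by
    refine TensorProduct.ext' fun a b => ?_
    simp only [LinearMap.comp_apply, LinearMap.sub_apply, map_tmul, form_tmul, braiding_d_aux₁,
      braiding_d_aux₂, LinearMap.id_apply]
    rw [add_sub_add_right_eq_sub]
    rfl
  intro t ht
  have := LinearMap.congr_fun key t
  rw [LinearMap.comp_apply _ C.form, LinearMap.mem_ker.1 ht, map_zero] at this
  rw [LinearMap.mem_ker, LinearMap.comp_apply]
  exact (Submodule.Quotient.mk_eq_zero _).2 this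

/-- The exterior derivative `d : E → Ω²(A)`, `a db ↦ da ∧ db`. -/
def dForm : E →ₗ[ℂ] C.TwoForms := C.extend _ C.dForm_aux

theorem dForm_form (a b : A) : C.dForm (a • C.d b) = C.wedge (tmulA A (C.d a) (C.d b)) := by
  rw [← form_tmul, dForm, extend_form]; rfl

end TwoForms

section Connections

/-- The restriction of the braiding to left-invariant tensors is diagonalisable. -/
def BraidingDiagonalisable : Prop := ⨆ μ : ℂ, C.braiding₀.eigenspace μ = ⊤

/-- A right connection on `E`. -/
def IsConnection (nabla : E →ₗ[ℂ] TensorA A E) : Prop :=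
  ∀ (ρ : E) (a : A), nabla (op a • ρ) = rActA a (nabla ρ) + tmulA A ρ (C.d a)

/-- The torsion `∧ ∘ ∇ + d`. -/
def torsion (nabla : E →ₗ[ℂ] TensorA A E) : E →ₗ[ℂ] C.TwoForms := C.wedge ∘ₗ nabla + C.dForm

/-- `(id ⊗ ∇) Δ_E = Δ_{E ⊗_A E} ∇`. -/
def IsLeftCovariant (nabla : E →ₗ[ℂ] TensorA A E) : Prop :=
  ∀ ρ : E, nabla.lTensor A (C.ΔL ρ) = C.ΔLA (nabla ρ)

/-- `(∇ ⊗ id) _EΔ = _{E ⊗_A E}Δ ∇`. -/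
def IsRightCovariant (nabla : E →ₗ[ℂ] TensorA A E) : Prop :=
  ∀ ρ : E, nabla.rTensor A (C.ΔR ρ) = C.ΔRA (nabla ρ)

/-- The sum `₀F` of the eigenspaces of the restricted braiding for eigenvalues other than `1`. -/
def F₀ : Submodule ℂ (TensorA A E) :=
  (⨆ μ : ℂ, ⨆ _ : μ ≠ 1, C.braiding₀.eigenspace μ).map C.leftInvA.subtype

/-- The right submodule `F = ₀F · A` of `E ⊗_A E`. -/
def F : Submodule ℂ (TensorA A E) :=
  Submodule.span ℂ {y | ∃ x ∈ C.F₀, ∃ a : A, y = rActA a x}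

/-- The restriction `Q : F → Ω²(A)` of `∧`. -/
def Q : C.F →ₗ[ℂ] C.TwoForms := C.wedge.domRestrict C.F

end Connections

end BicovariantCalculus

end QuantumCalculus

end

/-! Write `τ = σ - 1` on `E ⊗_A E`. Since `σ` is left `A`-linear and `E ⊗_A E = A · ₀(E ⊗_A E)`,
eigenvectors of `₀σ` multiplied by elements of `A` are eigenvectors of `σ`, so `σ` is diagonalisable
on all of `E ⊗_A E` (`iSup_eigenspace_braiding`). Hence `E ⊗_A E` is the direct sum of `ker τ` and
`range τ`; let `P` be the projection onto `range τ` along `ker τ`. Any map that commutes with `σ`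
commutes with `P` (`IsGroupInverse.intertwines`), and since `σ` is a bicovariant bimodule map, `P`
is right `A`-linear and bicovariant. As `ker ∧ = ker τ`, the wedge identifies `range τ` with
`Ω²(A)`, so `d : E → Ω²(A)` lifts to a bicovariant map `δ : E → range τ` (`dLift`) with `δ(ρa) =
δ(ρ)a - P(ρ ⊗_A da)`.

For every connection `∇`, the map `(1 - P)∇ - δ` is again a connection: the term `P(ρ ⊗_A da)`
removed by `1 - P` is restored by the Leibniz rule of `δ`. It is torsionless because `∧P = ∧` and
`∧δ = d`, and it is bicovariant when `∇` is. So any bicovariant connection suffices for existence.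
One is given by `ηa ↦ η ⊗_A da` for `η ∈ E₀`, made well defined by the decomposition `m ↦
m₍₀₎S(m₍₁₎) ⊗ m₍₂₎` of `E` along `E₀ · A`; this needs the antipode but not its inverse.

If `S` is bijective, `S⁻¹` gives likewise `E = ₀E · A` and a bicovariant connection `ωa ↦ ω ⊗_A da`
for `ω ∈ ₀E`. Removing its torsion gives a connection with value `-δ(ω)` on `ω ∈ ₀E`. Moreover `E
⊗_A E = ₀(E ⊗_A E) · A`, whence `F = range τ`, `Q` is bijective and `-δ(ω) = Q⁻¹(-dω)`. Uniqueness
follows from `E = ₀E · A` and the Leibniz rule. -/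

noncomputable section

namespace QuantumCalculus

/-! ### Spectral projections of a diagonalisable endomorphism, encoded by identities -/

section GroupInverse

variable {T T' : Type*} [AddCommGroup T] [Module ℂ T] [AddCommGroup T'] [Module ℂ T']

/-- `r` is an inverse of `τ` on the range of `τ`, and commutes with `τ`. -/
structure IsGroupInverse (τ r : Module.End ℂ T) : Prop where
  comm : τ * r = r * τ
  mul_mul : τ * r * τ = τ

namespace IsGroupInverse

variable {τ r : Module.End ℂ T} {τ' r' : Module.End ℂ T'}

/-- A map that intertwines `τ` and `τ'` intertwines the projections onto their ranges. -/
theorem intertwines (h : IsGroupInverse τ r) (h' : IsGroupInverse τ' r') {D : T →ₗ[ℂ] T'}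
    (hD : ∀ x, D (τ x) = τ' (D x)) (x : T) : D ((τ * r) x) = (τ' * r') (D x) := by
  -- `D` carries the range of `τ` into the range of `τ'`, on which the projection `τ' * r'` is the
  -- identity.
  have h₁ : (τ' * r') (D ((τ * r) x)) = D ((τ * r) x) := by
    rw [Module.End.mul_apply τ r, hD, ← Module.End.mul_apply, h'.mul_mul]
  -- `x - (τ * r) x` lies in `ker τ`, so `D` sends it into `ker τ'`, which `τ' * r'` kills.
  have h₂ : (τ' * r') (D ((τ * r) x)) = (τ' * r') (D x) := by
    have h₃ : τ ((τ * r) x) = τ x := by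
      rw [h.comm, ← Module.End.mul_apply, ← mul_assoc, h.mul_mul]
    rw [h'.comm, Module.End.mul_apply r', ← hD, h₃, hD, Module.End.mul_apply]
  exact h₁.symm.trans h₂

/-- The defining identities survive tensoring by functoriality alone, so the projection for `id ⊗ τ`
is obtained without identifying the kernel or range of `id ⊗ τ`. -/
theorem lTensor (h : IsGroupInverse τ r) (M : Type*) [AddCommGroup M] [Module ℂ M] :
    IsGroupInverse (τ.lTensor M) (r.lTensor M) := by
  constructor
  · rw [← LinearMap.lTensor_mul, ← LinearMap.lTensor_mul, h.comm]
  · rw [← LinearMap.lTensor_mul, ← LinearMap.lTensor_mul, h.mul_mul]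

theorem rTensor (h : IsGroupInverse τ r) (M : Type*) [AddCommGroup M] [Module ℂ M] :
    IsGroupInverse (τ.rTensor M) (r.rTensor M) := by
  constructor
  · rw [← LinearMap.rTensor_mul, ← LinearMap.rTensor_mul, h.comm]
  · rw [← LinearMap.rTensor_mul, ← LinearMap.rTensor_mul, h.mul_mul]

theorem apply_of_mem_ker (h : IsGroupInverse τ r) {x : T} (hx : x ∈ LinearMap.ker τ) :
    (τ * r) x = 0 := by
  rw [h.comm, Module.End.mul_apply, LinearMap.mem_ker.1 hx, map_zero]

theorem sub_mem_ker (h : IsGroupInverse τ r) (x : T) : x - (τ * r) x ∈ LinearMap.ker τ := by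
  rw [LinearMap.mem_ker, map_sub, h.comm, ← Module.End.mul_apply, ← mul_assoc, h.mul_mul, sub_self]

end IsGroupInverse

theorem ker_sub_id (σ : Module.End ℂ T) :
    LinearMap.ker (σ - LinearMap.id) = σ.eigenspace 1 := by
  ext x
  simp [sub_eq_zero]

/-- On the eigenspace for `μ`, `σ - 1` is the scalar `μ - 1`. It therefore vanishes for `μ = 1` and
is invertible otherwise, so its range is the sum of the other eigenspaces. -/
theorem isCompl_ker_range_sub_id {σ : Module.End ℂ T} (h : ⨆ μ, σ.eigenspace μ = ⊤) :
    IsCompl (LinearMap.ker (σ - LinearMap.id)) (LinearMap.range (σ - LinearMap.id)) := by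
  have hR : LinearMap.range (σ - LinearMap.id) = ⨆ μ, ⨆ _ : μ ≠ 1, σ.eigenspace μ := by
    apply le_antisymm
    · rintro _ ⟨y, rfl⟩
      have hy : y ∈ ⨆ μ, σ.eigenspace μ := h ▸ Submodule.mem_top
      induction hy using Submodule.iSup_induction' with
      | mem μ y hy =>
        rw [Module.End.mem_eigenspace_iff] at hy
        rw [LinearMap.sub_apply, hy, LinearMap.id_apply]
        by_cases hμ : μ = 1
        · simp [hμ]
        · have h₁ : y ∈ ⨆ μ, ⨆ _ : μ ≠ 1, σ.eigenspace μ :=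
            Submodule.mem_iSup_of_mem μ (Submodule.mem_iSup_of_mem hμ
              (Module.End.mem_eigenspace_iff.2 hy))
          exact sub_mem (Submodule.smul_mem _ _ h₁) h₁
      | zero => simp
      | add x y _ _ hx hy => rw [map_add]; exact add_mem hx hy
    · refine iSup₂_le fun μ hμ x hx => ⟨(μ - 1)⁻¹ • x, ?_⟩
      rw [Module.End.mem_eigenspace_iff] at hx
      rw [map_smul, LinearMap.sub_apply, hx, LinearMap.id_apply]
      nth_rewrite 2 [← one_smul ℂ x]
      rw [← sub_smul, smul_smul, inv_mul_cancel₀ (sub_ne_zero.2 hμ), one_smul]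
  rw [hR, ker_sub_id]
  refine ⟨σ.eigenspaces_iSupIndep 1, codisjoint_iff.2 ?_⟩
  rw [eq_top_iff, ← h]
  refine iSup_le fun μ => ?_
  by_cases hμ : μ = 1
  · exact hμ ▸ le_sup_left
  · exact le_sup_of_le_right (le_iSup₂_of_le μ hμ le_rfl)

/-- `τ` restricts to an automorphism of its range: injective because the range meets the kernel
trivially, surjective because `τ(k + z) = τ(z)` for `k` in the kernel. Take for `r` the inverse of
this restriction, extended by zero to the kernel. -/
theorem exists_isGroupInverse {τ : Module.End ℂ T}
    (h : IsCompl (LinearMap.ker τ) (LinearMap.range τ)) : ∃ r, IsGroupInverse τ r := by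
  let R := LinearMap.range τ
  let f : R →ₗ[ℂ] R := τ.restrict fun x _ => LinearMap.mem_range_self τ x
  have hf : Function.Bijective f := by
    constructor
    · rw [← LinearMap.ker_eq_bot, LinearMap.ker_eq_bot']
      intro x hx
      exact Subtype.ext (Submodule.disjoint_def.1 h.disjoint x
        (LinearMap.mem_ker.2 (congrArg Subtype.val hx)) x.2)
    · rintro ⟨_, y, rfl⟩
      have hy : y ∈ LinearMap.ker τ ⊔ LinearMap.range τ := by rw [h.sup_eq_top]; trivial
      obtain ⟨k, hk, z, hz, rfl⟩ := Submodule.mem_sup.1 hy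
      refine ⟨⟨z, hz⟩, Subtype.ext ?_⟩
      simp [f, LinearMap.mem_ker.1 hk]
  let e := LinearEquiv.ofBijective f hf
  let π := R.projectionOnto (LinearMap.ker τ) h.symm
  have he : ∀ x : R, τ (e.symm x) = x := fun x => congrArg Subtype.val (e.apply_symm_apply x)
  have hmem : ∀ x, (π x : T) - x ∈ LinearMap.ker τ := fun x => by
    rw [← neg_sub]
    refine neg_mem ?_
    have : π (x - π x) = 0 := by
      rw [map_sub, sub_eq_zero]
      exact (Submodule.projectionOnto_apply_left h.symm (π x)).symm
    exact (Submodule.projectionOnto_apply_eq_zero_iff h.symm).1 this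
  have hπ : ∀ x, τ (π x) = τ x := fun x => by
    rw [← sub_eq_zero, ← map_sub]; exact hmem x
  have hπ' : ∀ x, π (τ x) = ⟨τ x, LinearMap.mem_range_self τ x⟩ := fun x =>
    Submodule.projectionOnto_apply_left h.symm ⟨τ x, LinearMap.mem_range_self τ x⟩
  refine ⟨R.subtype ∘ₗ e.symm.toLinearMap ∘ₗ π, ?_, ?_⟩
  · ext x
    have : (⟨τ x, LinearMap.mem_range_self τ x⟩ : R) = e (π x) := Subtype.ext (hπ x).symm
    simp [he, hπ', this]
  · ext x
    simp [he, hπ']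

end GroupInverse

open Coalgebra HopfAlgebra

variable {A : Type*} [Ring A] [HopfAlgebra ℂ A]
variable {E : Type*} [AddCommGroup E] [Module ℂ E] [Module A E] [Module Aᵐᵒᵖ E]
  [IsScalarTower ℂ A E] [IsScalarTower ℂ Aᵐᵒᵖ E] [SMulCommClass A Aᵐᵒᵖ E]

namespace BicovariantCalculus

variable (C : BicovariantCalculus A E)

/-! ### Calculus in `E ⊗_A E`: right action and diagonal coactions -/

section TensorA

variable (A E) in
/-- `e ⊗ f ↦ e ⊗_A f` as a bilinear map. -/
def tmulₗ : E →ₗ[ℂ] E →ₗ[ℂ] TensorA A E := (TensorProduct.mk ℂ E E).compr₂ (balancedRel A E).mkQ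

@[simp] theorem tmulₗ_apply (e f : E) : tmulₗ A E e f = tmulA A e f := rfl

@[simp] theorem mkQ_tmul (e f : E) : (balancedRel A E).mkQ (e ⊗ₜ f) = tmulA A e f := rfl

theorem add_tmulA (e e' f : E) : tmulA A (e + e') f = tmulA A e f + tmulA A e' f :=
  (tmulₗ A E).map_add₂ e e' f

theorem tmulA_add (e f f' : E) : tmulA A e (f + f') = tmulA A e f + tmulA A e f' :=
  (tmulₗ A E e).map_add f f'

@[simp] theorem zero_tmulA (f : E) : tmulA A 0 f = 0 := (tmulₗ A E).map_zero₂ f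

@[simp] theorem tmulA_zero (e : E) : tmulA A e 0 = 0 := (tmulₗ A E e).map_zero

theorem smul_tmulA (c : ℂ) (e f : E) : tmulA A (c • e) f = c • tmulA A e f :=
  (tmulₗ A E).map_smul₂ c e f

theorem tmulA_smul (c : ℂ) (e f : E) : tmulA A e (c • f) = c • tmulA A e f :=
  (tmulₗ A E e).map_smul c f

theorem tensorA_induction {p : TensorA A E → Prop} (zero : p 0) (tmul : ∀ e f, p (tmulA A e f))
    (add : ∀ x y, p x → p y → p (x + y)) (x : TensorA A E) : p x := by
  obtain ⟨t, rfl⟩ := (balancedRel A E).mkQ_surjective x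
  induction t using TensorProduct.induction_on with
  | zero => simpa using zero
  | tmul e f => exact tmul e f
  | add s t hs ht => rw [map_add]; exact add _ _ hs ht

variable (A E) in
/-- The right action on `E ⊗_A E` as a bilinear map. -/
def rActₗ : TensorA A E →ₗ[ℂ] A →ₗ[ℂ] TensorA A E :=
  LinearMap.mk₂ ℂ (fun x a => rActA a x) (fun x y a => map_add _ x y)
    (fun c x a => map_smul _ c x)
    (fun x a b => by
      induction x using tensorA_induction with
      | zero => simp
      | tmul e f => simp [add_smul, tmulA_add]
      | add x y hx hy => simp only [map_add, hx, hy]; abel)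
    (fun c x a => by
      induction x using tensorA_induction with
      | zero => simp
      | tmul e f => simp [smul_assoc, tmulA_smul]
      | add x y hx hy => simp only [map_add, hx, hy, smul_add])

@[simp] theorem rActₗ_apply (x : TensorA A E) (a : A) : rActₗ A E x a = rActA a x := rfl

variable (A E) in
/-- `(c ⊗ x) (a ⊗ b) = ca ⊗ xb`, the right action of `A ⊗ A` on `A ⊗ (E ⊗_A E)`. -/
def rmulLA : A ⊗[ℂ] TensorA A E →ₗ[ℂ] A ⊗[ℂ] A →ₗ[ℂ] A ⊗[ℂ] TensorA A E :=
  map₂ (LinearMap.mul ℂ A) (rActₗ A E)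

variable (A E) in
/-- `(x ⊗ c) (a ⊗ b) = xa ⊗ cb`, the right action of `A ⊗ A` on `(E ⊗_A E) ⊗ A`. -/
def rmulRA : TensorA A E ⊗[ℂ] A →ₗ[ℂ] A ⊗[ℂ] A →ₗ[ℂ] TensorA A E ⊗[ℂ] A :=
  map₂ (rActₗ A E) (LinearMap.mul ℂ A)

@[simp] theorem rmulLA_tmul (a b c : A) (x : TensorA A E) :
    rmulLA A E (c ⊗ₜ x) (a ⊗ₜ b) = (c * a) ⊗ₜ rActA b x := rfl
@[simp] theorem rmulRA_tmul (a b c : A) (x : TensorA A E) :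
    rmulRA A E (x ⊗ₜ c) (a ⊗ₜ b) = rActA a x ⊗ₜ (c * b) := rfl

variable (A E) in
/-- `(a ⊗ e) (b ⊗ f) = ab ⊗ (e ⊗_A f)`. -/
def mulL : A ⊗[ℂ] E →ₗ[ℂ] A ⊗[ℂ] E →ₗ[ℂ] A ⊗[ℂ] TensorA A E :=
  map₂ (LinearMap.mul ℂ A) (tmulₗ A E)

variable (A E) in
/-- `(e ⊗ a) (f ⊗ b) = (e ⊗_A f) ⊗ ab`. -/
def mulR : E ⊗[ℂ] A →ₗ[ℂ] E ⊗[ℂ] A →ₗ[ℂ] TensorA A E ⊗[ℂ] A :=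
  map₂ (tmulₗ A E) (LinearMap.mul ℂ A)

@[simp] theorem mulL_tmul (a b : A) (e f : E) :
    mulL A E (a ⊗ₜ e) (b ⊗ₜ f) = (a * b) ⊗ₜ tmulA A e f := rfl
@[simp] theorem mulR_tmul (a b : A) (e f : E) :
    mulR A E (e ⊗ₜ a) (f ⊗ₜ b) = tmulA A e f ⊗ₜ (a * b) := rfl

/-- Written as a product of coactions, the diagonal coaction can be moved past right multiplication
through `mulL_rmulL`. -/
theorem ΔLA_eq_mulL (m n : E) : C.ΔLA (tmulA A m n) = mulL A E (C.ΔL m) (C.ΔL n) := by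
  rw [ΔLA_tmulA]
  generalize C.ΔL m = u
  generalize C.ΔL n = v
  induction u using TensorProduct.induction_on with
  | zero => simp
  | add s s' h h' => simp only [map_add, LinearMap.add_apply, add_tmul, h, h']
  | tmul b e =>
  induction v using TensorProduct.induction_on with
  | zero => simp
  | add s s' h h' => simp only [map_add, tmul_add, h, h']
  | tmul c f => simp [tmulA]

theorem ΔRA_eq_mulR (m n : E) : C.ΔRA (tmulA A m n) = mulR A E (C.ΔR m) (C.ΔR n) := by
  rw [ΔRA_tmulA]
  generalize C.ΔR m = u
  generalize C.ΔR n = v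
  induction u using TensorProduct.induction_on with
  | zero => simp
  | add s s' h h' => simp only [map_add, LinearMap.add_apply, add_tmul, h, h']
  | tmul b e =>
  induction v using TensorProduct.induction_on with
  | zero => simp
  | add s s' h h' => simp only [map_add, tmul_add, h, h']
  | tmul c f => simp [tmulA]

theorem mulL_rmulL (u v : A ⊗[ℂ] E) (t : A ⊗[ℂ] A) :
    mulL A E u (rmulL A E v t) = rmulLA A E (mulL A E u v) t := by
  induction u using TensorProduct.induction_on with
  | zero => simp
  | add s s' h h' => simp only [map_add, LinearMap.add_apply, h, h']
  | tmul b e =>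
  induction v using TensorProduct.induction_on with
  | zero => simp
  | add s s' h h' => simp only [map_add, LinearMap.add_apply, h, h']
  | tmul c f =>
  induction t using TensorProduct.induction_on with
  | zero => simp
  | add s s' h h' => simp only [map_add, h, h']
  | tmul a a' => simp [mul_assoc]

theorem mulR_rmulR (u v : E ⊗[ℂ] A) (t : A ⊗[ℂ] A) :
    mulR A E u (rmulR A E v t) = rmulRA A E (mulR A E u v) t := by
  induction u using TensorProduct.induction_on with
  | zero => simp
  | add s s' h h' => simp only [map_add, LinearMap.add_apply, h, h']
  | tmul b e =>
  induction v using TensorProduct.induction_on with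
  | zero => simp
  | add s s' h h' => simp only [map_add, LinearMap.add_apply, h, h']
  | tmul c f =>
  induction t using TensorProduct.induction_on with
  | zero => simp
  | add s s' h h' => simp only [map_add, h, h']
  | tmul a a' => simp [mul_assoc]

theorem ΔLA_rActA (a : A) (x : TensorA A E) :
    C.ΔLA (rActA a x) = rmulLA A E (C.ΔLA x) (comul a) := by
  induction x using tensorA_induction with
  | zero => simp
  | tmul e f => rw [rActA_tmulA, ΔLA_eq_mulL, ΔLA_eq_mulL, ΔL_op_smul, mulL_rmulL]
  | add x y hx hy => simp only [map_add, LinearMap.add_apply, hx, hy]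

theorem ΔRA_rActA (a : A) (x : TensorA A E) :
    C.ΔRA (rActA a x) = rmulRA A E (C.ΔRA x) (comul a) := by
  induction x using tensorA_induction with
  | zero => simp
  | tmul e f => rw [rActA_tmulA, ΔRA_eq_mulR, ΔRA_eq_mulR, ΔR_op_smul, mulR_rmulR]
  | add x y hx hy => simp only [map_add, LinearMap.add_apply, hx, hy]

end TensorA

/-! ### Generation by invariant elements, and diagonalisability of `σ` on all of `E ⊗_A E` -/

section Spanning

/-- `E = A · ₀E`. -/
theorem span_smul_leftInv :
    Submodule.span ℂ {e : E | ∃ a : A, ∃ ω ∈ C.leftInv, e = a • ω} = ⊤ := by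
  rw [eq_top_iff]
  rintro m -
  rw [← C.lam_reconstruct m, lam, LinearMap.comp_apply]
  generalize C.ΔL m = u
  induction u using TensorProduct.induction_on with
  | zero => simp
  | add s s' h h' => simp only [map_add]; exact add_mem h h'
  | tmul b e => exact Submodule.subset_span ⟨b, _, C.projL_mem e, rfl⟩

/-- `E = E₀ · A`. -/
theorem span_rightInv_smul :
    Submodule.span ℂ {e : E | ∃ η ∈ C.rightInv, ∃ a : A, e = op a • η} = ⊤ := by
  rw [eq_top_iff]
  rintro m -
  rw [← C.rho_reconstruct m, rho, LinearMap.comp_apply]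
  generalize C.ΔR m = u
  induction u using TensorProduct.induction_on with
  | zero => simp
  | add s s' h h' => simp only [map_add]; exact add_mem h h'
  | tmul e b => exact Submodule.subset_span ⟨_, C.projR_mem e, b, rfl⟩

theorem tmulA_mem_leftInvA {ω ω' : E} (h : ω ∈ C.leftInv) (h' : ω' ∈ C.leftInv) :
    tmulA A ω ω' ∈ C.leftInvA := by
  rw [mem_leftInvA, ΔLA_eq_mulL, C.mem_leftInv.1 h, C.mem_leftInv.1 h', mulL_tmul, mul_one]

/-- `E ⊗_A E = A · ₀(E ⊗_A E)`. -/
theorem span_lActA_leftInvA :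
    Submodule.span ℂ {y | ∃ a : A, ∃ x ∈ C.leftInvA, y = lActA a x} = ⊤ := by
  rw [eq_top_iff]
  rintro x -
  induction x using tensorA_induction with
  | zero => simp
  | add x y hx hy => exact add_mem hx hy
  | tmul m n =>
    have hn : n ∈ Submodule.span ℂ {e : E | ∃ a : A, ∃ ω ∈ C.leftInv, e = a • ω} :=
      C.span_smul_leftInv ▸ Submodule.mem_top
    induction hn using Submodule.span_induction with
    | zero => simp
    | add x y _ _ hx hy => rw [tmulA_add]; exact add_mem hx hy
    | smul c x _ hx => rw [tmulA_smul]; exact Submodule.smul_mem _ _ hx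
    | mem n hn =>
      obtain ⟨a, ω', hω', rfl⟩ := hn
      -- Slide the coefficient across, `m ⊗_A aω' = ma ⊗_A ω'`, and then expand `ma` along `A · ₀E`.
      rw [← tmulA_balanced]
      generalize op a • m = m'
      have hm : m' ∈ Submodule.span ℂ {e : E | ∃ a : A, ∃ ω ∈ C.leftInv, e = a • ω} :=
        C.span_smul_leftInv ▸ Submodule.mem_top
      induction hm using Submodule.span_induction with
      | zero => simp
      | add x y _ _ hx hy => rw [add_tmulA]; exact add_mem hx hy
      | smul c x _ hx => rw [smul_tmulA]; exact Submodule.smul_mem _ _ hx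
      | mem m hm =>
        obtain ⟨b, ω, hω, rfl⟩ := hm
        exact Submodule.subset_span ⟨b, _, C.tmulA_mem_leftInvA hω hω', (lActA_tmulA _ _ _).symm⟩

/-- Left multiplication by `a` commutes with `σ`, so it preserves each eigenspace; the products of
`A` with the invariant eigenvectors already span. -/
theorem iSup_eigenspace_braiding (h : C.BraidingDiagonalisable) :
    ⨆ μ, Module.End.eigenspace C.braiding μ = ⊤ := by
  rw [eq_top_iff, ← C.span_lActA_leftInvA, Submodule.span_le]
  rintro _ ⟨a, x, hx, rfl⟩
  have hx' : (⟨x, hx⟩ : C.leftInvA) ∈ ⨆ μ : ℂ, C.braiding₀.eigenspace μ :=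
    (h : ⨆ μ : ℂ, C.braiding₀.eigenspace μ = ⊤) ▸ Submodule.mem_top
  suffices ∀ y ∈ ⨆ μ : ℂ, C.braiding₀.eigenspace μ,
      lActA a (y : TensorA A E) ∈ ⨆ μ, Module.End.eigenspace C.braiding μ from this _ hx'
  intro y hy
  induction hy using Submodule.iSup_induction' with
  | zero => simp
  | add x y _ _ hx hy => rw [Submodule.coe_add, map_add]; exact add_mem hx hy
  | mem μ y hy =>
    refine Submodule.mem_iSup_of_mem μ ?_
    rw [Module.End.mem_eigenspace_iff] at hy ⊢
    have : C.braiding y = μ • (y : TensorA A E) := congrArg Subtype.val hy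
    rw [braiding_lActA, this, map_smul]

theorem isCompl_braiding (h : C.BraidingDiagonalisable) :
    IsCompl (LinearMap.ker (C.braiding - LinearMap.id))
      (LinearMap.range (C.braiding - LinearMap.id)) :=
  isCompl_ker_range_sub_id (C.iSup_eigenspace_braiding h)

end Spanning

/-! ### Right covariance of the braiding -/

section RightCovariance

/-- The two coactions commute, so the right coaction sends `₀E` into `₀E ⊗ A`. This is stated by
saying that `projL` fixes the first leg, which serves in place of membership in a tensor product of
subspaces; the second half lets `σ` be evaluated on that leg. -/
theorem projL_rTensor_ΔR {ω : E} (hω : ω ∈ C.leftInv) :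
    C.projL.rTensor A (C.ΔR ω) = C.ΔR ω ∧
      C.lam.rTensor A (C.ΔR ω) = (TensorProduct.mk ℂ A E 1).rTensor A (C.ΔR ω) := by
  have h₀ : C.ΔL.rTensor A (C.ΔR ω) = (TensorProduct.mk ℂ A E 1).rTensor A (C.ΔR ω) := by
    apply (TensorProduct.assoc ℂ A E A).injective
    rw [ΔL_ΔR, C.mem_leftInv.1 hω, LinearMap.lTensor_tmul]
    generalize C.ΔR ω = u
    induction u using TensorProduct.induction_on with
    | zero => simp
    | add s s' h h' => simp only [map_add, tmul_add, h, h']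
    | tmul b e => simp
  have h₁ : C.projL.rTensor A (C.ΔR ω) = C.ΔR ω := by
    rw [projL, ← LinearMap.comp_assoc, LinearMap.rTensor_comp, LinearMap.comp_apply, h₀]
    generalize C.ΔR ω = u
    induction u using TensorProduct.induction_on with
    | zero => simp
    | add s s' h h' => simp only [map_add, h, h']
    | tmul b e => simp
  refine ⟨h₁, ?_⟩
  rw [lam, LinearMap.rTensor_comp, LinearMap.comp_apply, h₀]
  conv_rhs => rw [← h₁]
  generalize C.ΔR ω = u
  induction u using TensorProduct.induction_on with
  | zero => simp
  | add s s' h h' => simp only [map_add, h, h']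
  | tmul b e => simp

/-- On a generator `aω ⊗_A ηb` the braiding is a flip. The right coaction fixes `η` and keeps the
first leg of `ω` left-invariant, so after coacting the braiding is still a flip. -/
theorem braiding_rightCovariant (x : TensorA A E) :
    C.ΔRA (C.braiding x) = C.braiding.rTensor A (C.ΔRA x) := by
  suffices C.ΔRA ∘ₗ C.braiding = C.braiding.rTensor A ∘ₗ C.ΔRA from LinearMap.congr_fun this x
  refine C.ext_inv fun a b ω η hω hη => ?_
  have hr := (C.projL_rTensor_ΔR hω).2
  have hσ : C.braiding (tmulA A (a • ω) (op b • η)) = tmulA A (a • η) (op b • ω) := by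
    rw [← rActA_tmulA, ← lActA_tmulA, braiding_rActA, braiding_lActA, C.braiding_flip hω hη]
    simp
  simp only [LinearMap.comp_apply, hσ, ΔRA_eq_mulR, ΔR_smul, ΔR_op_smul, C.mem_rightInv.1 hη]
  generalize C.ΔR ω = u at hr
  generalize comul (R := ℂ) a = s
  generalize comul (R := ℂ) b = t
  induction s using TensorProduct.induction_on with
  | zero => simp
  | add s s' h h' => simp only [map_add, LinearMap.add_apply, h, h']
  | tmul a₁ a₂ =>
  induction t using TensorProduct.induction_on with
  | zero => simp
  | add s s' h h' => simp only [map_add, h, h']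
  | tmul b₁ b₂ =>
  -- Both sides are values of `Z`: braiding first gives `Z` on `(1 ⊗ ω₍₀₎) ⊗ ω₍₁₎`, coacting first
  -- gives `Z` on `lam ω₍₀₎ ⊗ ω₍₁₎`. These arguments agree by `hr`.
  let Z : (A ⊗[ℂ] E) ⊗[ℂ] A →ₗ[ℂ] TensorA A E ⊗[ℂ] A :=
    map (lActA a₁ ∘ₗ cross A E ∘ₗ (TensorProduct.mk ℂ (A ⊗[ℂ] E) (E ⊗[ℂ] A)).flip (η ⊗ₜ b₁))
      ((LinearMap.mul ℂ A).flip b₂ ∘ₗ LinearMap.mul ℂ A a₂)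
  have hl : ∀ u : E ⊗[ℂ] A, mulR A E (lmulR A E (a₁ ⊗ₜ a₂) (η ⊗ₜ 1))
      (rmulR A E u (b₁ ⊗ₜ b₂)) = Z ((TensorProduct.mk ℂ A E 1).rTensor A u) := by
    intro u
    induction u using TensorProduct.induction_on with
    | zero => simp
    | add s s' h h' => simp only [map_add, LinearMap.add_apply, h, h']
    | tmul e c => simp [Z, mul_assoc]
  have hl' : ∀ u : E ⊗[ℂ] A, C.braiding.rTensor A (mulR A E (lmulR A E (a₁ ⊗ₜ a₂) u)
      (rmulR A E (η ⊗ₜ 1) (b₁ ⊗ₜ b₂))) = Z (C.lam.rTensor A u) := by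
    intro u
    induction u using TensorProduct.induction_on with
    | zero => simp
    | add s s' h h' => simp only [map_add, LinearMap.add_apply, h, h']
    | tmul e c =>
      have : C.braiding (tmulA A (a₁ • e) (op b₁ • η)) =
          lActA a₁ (cross A E (C.lam e ⊗ₜ (η ⊗ₜ b₁))) := by
        rw [← lActA_tmulA, braiding_lActA, braiding_tmulA, rho_op_smul, C.rho_of_mem hη]
        simp
      simp [Z, mul_assoc, this]
  rw [hl, hl', hr]

end RightCovariance

/-! ### The projection onto `range (σ - 1)` and the lift of the exterior derivative -/

section Alternation

variable {r : Module.End ℂ (TensorA A E)}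

/-- The projection onto the range of `σ - 1` along its kernel, where `r` is a group inverse
of `σ - 1`. -/
def alt (r : Module.End ℂ (TensorA A E)) : Module.End ℂ (TensorA A E) :=
  (C.braiding - LinearMap.id) * r

/-- Right multiplication commutes with `σ - 1`, hence with its spectral projection. -/
theorem alt_rActA (hr : IsGroupInverse (C.braiding - LinearMap.id) r) (a : A)
    (x : TensorA A E) : C.alt r (rActA a x) = rActA a (C.alt r x) :=
  (hr.intertwines hr (D := rActA a)
    (fun y => by simp only [LinearMap.sub_apply, map_sub, braiding_rActA, LinearMap.id_apply])
    x).symm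

/-- The coaction intertwines `σ - 1` with `id ⊗ (σ - 1)`, hence also the two projections. -/
theorem ΔLA_alt (hr : IsGroupInverse (C.braiding - LinearMap.id) r) (x : TensorA A E) :
    C.ΔLA (C.alt r x) = (C.alt r).lTensor A (C.ΔLA x) := by
  rw [alt, LinearMap.lTensor_mul]
  refine hr.intertwines (hr.lTensor A) (fun y => ?_) x
  rw [LinearMap.lTensor_sub, LinearMap.lTensor_id, LinearMap.sub_apply, LinearMap.sub_apply,
    map_sub, braiding_leftCovariant, LinearMap.id_apply, LinearMap.id_apply]

theorem ΔRA_alt (hr : IsGroupInverse (C.braiding - LinearMap.id) r) (x : TensorA A E) :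
    C.ΔRA (C.alt r x) = (C.alt r).rTensor A (C.ΔRA x) := by
  rw [alt, LinearMap.rTensor_mul]
  refine hr.intertwines (hr.rTensor A) (fun y => ?_) x
  rw [LinearMap.rTensor_sub, LinearMap.rTensor_id, LinearMap.sub_apply, LinearMap.sub_apply,
    map_sub, braiding_rightCovariant, LinearMap.id_apply, LinearMap.id_apply]

theorem wedge_alt (hr : IsGroupInverse (C.braiding - LinearMap.id) r) (x : TensorA A E) :
    C.wedge (C.alt r x) = C.wedge x :=
  ((Submodule.Quotient.eq _).2 (hr.sub_mem_ker x)).symm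

/-- The splitting `Ω²(A) → E ⊗_A E` of `∧` with values in the range of `σ - 1`. -/
def wedgeSection (hr : IsGroupInverse (C.braiding - LinearMap.id) r) :
    C.TwoForms →ₗ[ℂ] TensorA A E :=
  (LinearMap.ker (C.braiding - LinearMap.id)).liftQ (C.alt r) fun _ => hr.apply_of_mem_ker

theorem wedgeSection_wedge (hr : IsGroupInverse (C.braiding - LinearMap.id) r)
    (x : TensorA A E) : C.wedgeSection hr (C.wedge x) = C.alt r x := rfl

theorem wedge_wedgeSection (hr : IsGroupInverse (C.braiding - LinearMap.id) r)
    (y : C.TwoForms) : C.wedge (C.wedgeSection hr y) = y := by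
  obtain ⟨x, rfl⟩ := Submodule.mkQ_surjective _ y
  exact C.wedge_alt hr x

/-- The exterior derivative lifted to `E ⊗_A E`, with values in the range of `σ - 1`. -/
def dLift (hr : IsGroupInverse (C.braiding - LinearMap.id) r) : E →ₗ[ℂ] TensorA A E :=
  C.wedgeSection hr ∘ₗ C.dForm

theorem wedge_dLift (hr : IsGroupInverse (C.braiding - LinearMap.id) r) (ρ : E) :
    C.wedge (C.dLift hr ρ) = C.dForm ρ := C.wedge_wedgeSection hr _

theorem dLift_mem_range (hr : IsGroupInverse (C.braiding - LinearMap.id) r) (ρ : E) :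
    C.dLift hr ρ ∈ LinearMap.range (C.braiding - LinearMap.id) := by
  obtain ⟨x, hx⟩ := Submodule.mkQ_surjective _ (C.dForm ρ)
  rw [dLift, LinearMap.comp_apply, ← hx]
  exact ⟨r x, rfl⟩

theorem dLift_form (hr : IsGroupInverse (C.braiding - LinearMap.id) r) (a b : A) :
    C.dLift hr (a • C.d b) = C.alt r (tmulA A (C.d a) (C.d b)) := by
  rw [dLift, LinearMap.comp_apply, dForm_form, wedgeSection_wedge]

theorem span_smul_d : Submodule.span ℂ {e : E | ∃ a b : A, e = a • C.d b} = ⊤ := by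
  rw [eq_top_iff]
  rintro ρ -
  obtain ⟨n, a, b, rfl⟩ := C.exists_sum ρ
  exact sum_mem fun k _ => Submodule.subset_span ⟨a k, b k, rfl⟩

/-- This is the graded Leibniz rule `d(ρc) = (dρ)c - ρ ∧ dc`, lifted to `range (σ - 1)`. -/
theorem dLift_op_smul (hr : IsGroupInverse (C.braiding - LinearMap.id) r) (c : A) (ρ : E) :
    C.dLift hr (op c • ρ) = rActA c (C.dLift hr ρ) - C.alt r (tmulA A ρ (C.d c)) := by
  have hρ : ρ ∈ Submodule.span ℂ {e : E | ∃ a b : A, e = a • C.d b} :=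
    C.span_smul_d ▸ Submodule.mem_top
  induction hρ using Submodule.span_induction with
  | zero => simp
  | add x y _ _ hx hy => simp only [smul_add, map_add, hx, hy, add_tmulA]; abel
  | smul k x _ hx => simp only [smul_comm (op c) k, map_smul, hx, smul_tmulA, smul_sub]
  | mem e he =>
    obtain ⟨a, b, rfl⟩ := he
    -- With `(a db)c = a d(bc) - ab dc`, the lift is `alt` of `da ⊗_A d(bc) - d(ab) ⊗_A dc`. After
    -- both Leibniz expansions the terms `da ⊗_A b dc` and `(da)b ⊗_A dc` cancel by balancing.
    rw [form_op_smul, map_sub, dLift_form, dLift_form, dLift_form, C.leibniz, C.leibniz,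
      ← alt_rActA C hr, rActA_tmulA, tmulA_add, add_tmulA, tmulA_balanced, ← map_sub, ← map_sub]
    congr 1
    abel

/-- On `a db` the lift is `alt (da ⊗_A db)`. Both `d : A → E` and `alt` commute with the left
coactions, and the coaction on the tensor is diagonal. -/
theorem dLift_leftCovariant (hr : IsGroupInverse (C.braiding - LinearMap.id) r) (ρ : E) :
    (C.dLift hr).lTensor A (C.ΔL ρ) = C.ΔLA (C.dLift hr ρ) := by
  have h : ∀ s t : A ⊗[ℂ] A, (C.dLift hr).lTensor A (lmulL A E s (C.d.lTensor A t)) =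
      (C.alt r).lTensor A (mulL A E (C.d.lTensor A s) (C.d.lTensor A t)) := by
    intro s t
    induction s using TensorProduct.induction_on with
    | zero => simp
    | add s s' h h' => simp only [map_add, LinearMap.add_apply, h, h']
    | tmul a b =>
    induction t using TensorProduct.induction_on with
    | zero => simp
    | add s s' h h' => simp only [map_add, h, h']
    | tmul a' b' => simp [dLift_form]
  suffices (C.dLift hr).lTensor A ∘ₗ C.ΔL = C.ΔLA ∘ₗ C.dLift hr from LinearMap.congr_fun this ρ
  refine C.ext_form fun a b => ?_
  rw [LinearMap.comp_apply, LinearMap.comp_apply, ΔL_form, h, dLift_form, ΔLA_alt C hr,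
    ΔLA_eq_mulL, ΔL_d, ΔL_d]

theorem dLift_rightCovariant (hr : IsGroupInverse (C.braiding - LinearMap.id) r) (ρ : E) :
    (C.dLift hr).rTensor A (C.ΔR ρ) = C.ΔRA (C.dLift hr ρ) := by
  have h : ∀ s t : A ⊗[ℂ] A, (C.dLift hr).rTensor A (lmulR A E s (C.d.rTensor A t)) =
      (C.alt r).rTensor A (mulR A E (C.d.rTensor A s) (C.d.rTensor A t)) := by
    intro s t
    induction s using TensorProduct.induction_on with
    | zero => simp
    | add s s' h h' => simp only [map_add, LinearMap.add_apply, h, h']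
    | tmul a b =>
    induction t using TensorProduct.induction_on with
    | zero => simp
    | add s s' h h' => simp only [map_add, h, h']
    | tmul a' b' => simp [dLift_form]
  suffices (C.dLift hr).rTensor A ∘ₗ C.ΔR = C.ΔRA ∘ₗ C.dLift hr from LinearMap.congr_fun this ρ
  refine C.ext_form fun a b => ?_
  rw [LinearMap.comp_apply, LinearMap.comp_apply, ΔR_form, h, dLift_form, ΔRA_alt C hr,
    ΔRA_eq_mulR, ΔR_d, ΔR_d]

end Alternation

/-! ### Removing the torsion of a connection -/

section TorsionRemoval

variable {r : Module.End ℂ (TensorA A E)} (hr : IsGroupInverse (C.braiding - LinearMap.id) r)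

/-- The connection obtained from `nabla` by subtracting the lift of its torsion. -/
def torsionless (nabla : E →ₗ[ℂ] TensorA A E) : E →ₗ[ℂ] TensorA A E :=
  nabla - C.alt r ∘ₗ nabla - C.dLift hr

theorem torsionless_apply (nabla : E →ₗ[ℂ] TensorA A E) (ρ : E) :
    C.torsionless hr nabla ρ = nabla ρ - C.alt r (nabla ρ) - C.dLift hr ρ := rfl

variable {C} {nabla : E →ₗ[ℂ] TensorA A E}

/-- The part `alt (ρ ⊗_A da)` that `alt ∘ nabla` takes away from the Leibniz term is given back by
`dLift_op_smul`. -/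
theorem IsConnection.torsionless (h : C.IsConnection nabla) :
    C.IsConnection (C.torsionless hr nabla) := by
  intro ρ a
  simp only [torsionless_apply, h ρ a, dLift_op_smul, map_add, map_sub, alt_rActA C hr]
  abel

theorem IsLeftCovariant.torsionless (h : C.IsLeftCovariant nabla) :
    C.IsLeftCovariant (C.torsionless hr nabla) := by
  intro ρ
  rw [torsionless_apply, map_sub, map_sub, ΔLA_alt C hr, ← h, ← dLift_leftCovariant,
    BicovariantCalculus.torsionless, LinearMap.lTensor_sub, LinearMap.lTensor_sub,
    LinearMap.lTensor_comp]
  rfl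

theorem IsRightCovariant.torsionless (h : C.IsRightCovariant nabla) :
    C.IsRightCovariant (C.torsionless hr nabla) := by
  intro ρ
  rw [torsionless_apply, map_sub, map_sub, ΔRA_alt C hr, ← h, ← dLift_rightCovariant,
    BicovariantCalculus.torsionless, LinearMap.rTensor_sub, LinearMap.rTensor_sub,
    LinearMap.rTensor_comp]
  rfl

variable (C nabla) in
-- `∧ ∘ alt = ∧` cancels both `nabla` terms, and `∧ ∘ dLift = d` cancels the exterior derivative in
-- the torsion.
theorem torsion_torsionless : C.torsion (C.torsionless hr nabla) = 0 := by
  ext ρ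
  simp only [torsion, LinearMap.add_apply, LinearMap.comp_apply, torsionless_apply, map_sub,
    C.wedge_alt hr, wedge_dLift, LinearMap.zero_apply]
  abel

end TorsionRemoval

/-! ### Connections from invariant forms, and the one that vanishes on `E₀` -/

section BaseConnections

/-- `m ⊗ a ↦ m ⊗_A da`, applied to a decomposition of the elements of `E` along `E ⊗ A`. -/
def baseConnection (φ : E →ₗ[ℂ] E ⊗[ℂ] A) : E →ₗ[ℂ] TensorA A E :=
  (balancedRel A E).mkQ ∘ₗ C.d.lTensor E ∘ₗ φ

/-- For a term `e ⊗ b` of `φ ρ`, the Leibniz rule gives `e ⊗_A d(ba) = (e ⊗_A db)a + eb ⊗_A da`. The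
last terms add up to `ρ ⊗_A da` because the products `eb` add up to `ρ`. -/
theorem baseConnection_isConnection {φ : E →ₗ[ℂ] E ⊗[ℂ] A}
    (hφ : ∀ (a : A) (m : E), φ (op a • m) = ((LinearMap.mul ℂ A).flip a).lTensor E (φ m))
    (hφ' : ∀ m, lift (rAct A E) (φ m) = m) : C.IsConnection (C.baseConnection φ) := by
  intro ρ a
  have h : ∀ u : E ⊗[ℂ] A, (balancedRel A E).mkQ (C.d.lTensor E
      (((LinearMap.mul ℂ A).flip a).lTensor E u)) =
      rActA a ((balancedRel A E).mkQ (C.d.lTensor E u)) +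
        tmulA A (lift (rAct A E) u) (C.d a) := by
    intro u
    induction u using TensorProduct.induction_on with
    | zero => simp
    | add s s' h h' => simp only [map_add, h, h', add_tmulA]; abel
    | tmul e b => simp [C.leibniz, tmulA_add, tmulA_balanced, -Submodule.mkQ_apply]
  simp only [baseConnection, LinearMap.comp_apply, hφ, h, hφ']

variable {C} {nabla : E →ₗ[ℂ] TensorA A E}

/-- Left covariance of a connection propagates along right multiplication. -/
theorem IsConnection.leftCovariant_op_smul (h : C.IsConnection nabla) {ρ : E}
    (hρ : nabla.lTensor A (C.ΔL ρ) = C.ΔLA (nabla ρ)) (a : A) :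
    nabla.lTensor A (C.ΔL (op a • ρ)) = C.ΔLA (nabla (op a • ρ)) := by
  have h₁ : ∀ (u : A ⊗[ℂ] E) (t : A ⊗[ℂ] A), nabla.lTensor A (rmulL A E u t) =
      rmulLA A E (nabla.lTensor A u) t + mulL A E u (C.d.lTensor A t) := by
    intro u t
    induction u using TensorProduct.induction_on with
    | zero => simp
    | add s s' h h' => simp only [map_add, LinearMap.add_apply, h, h']; abel
    | tmul b e =>
    induction t using TensorProduct.induction_on with
    | zero => simp
    | add s s' h h' => simp only [map_add, h, h']; abel
    | tmul c c' => simp [h e, tmul_add]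
  rw [ΔL_op_smul, h₁, hρ, h ρ a, map_add, ΔLA_rActA, ΔLA_eq_mulL, ΔL_d]

/-- Right covariance of a connection propagates along right multiplication. -/
theorem IsConnection.rightCovariant_op_smul (h : C.IsConnection nabla) {ρ : E}
    (hρ : nabla.rTensor A (C.ΔR ρ) = C.ΔRA (nabla ρ)) (a : A) :
    nabla.rTensor A (C.ΔR (op a • ρ)) = C.ΔRA (nabla (op a • ρ)) := by
  have h₁ : ∀ (u : E ⊗[ℂ] A) (t : A ⊗[ℂ] A), nabla.rTensor A (rmulR A E u t) =
      rmulRA A E (nabla.rTensor A u) t + mulR A E u (C.d.rTensor A t) := by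
    intro u t
    induction u using TensorProduct.induction_on with
    | zero => simp
    | add s s' h h' => simp only [map_add, LinearMap.add_apply, h, h']; abel
    | tmul b e =>
    induction t using TensorProduct.induction_on with
    | zero => simp
    | add s s' h h' => simp only [map_add, h, h']; abel
    | tmul c c' => simp [h b, add_tmul]
  rw [ΔR_op_smul, h₁, hρ, h ρ a, map_add, ΔRA_rActA, ΔRA_eq_mulR, ΔR_d]

/-- Two linear maps on `E = S · A` are equal if they agree on the elements `ηa`, `η ∈ S`. -/
theorem eq_of_span_op_smul {V : Type*} [AddCommGroup V] [Module ℂ V] {S : Submodule ℂ E}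
    (hS : Submodule.span ℂ {e : E | ∃ η ∈ S, ∃ a : A, e = op a • η} = ⊤) {f g : E →ₗ[ℂ] V}
    (h : ∀ η ∈ S, ∀ a : A, f (op a • η) = g (op a • η)) : f = g := by
  refine LinearMap.ext_on hS ?_
  rintro _ ⟨η, hη, a, rfl⟩
  exact h η hη a

/-- This reduces covariance to invariant generators; it serves for both `S = E₀` and `S = ₀E`. -/
theorem IsConnection.isLeftCovariant (h : C.IsConnection nabla) {S : Submodule ℂ E}
    (hS : Submodule.span ℂ {e : E | ∃ η ∈ S, ∃ a : A, e = op a • η} = ⊤)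
    (hc : ∀ η ∈ S, nabla.lTensor A (C.ΔL η) = C.ΔLA (nabla η)) : C.IsLeftCovariant nabla :=
  LinearMap.congr_fun (f := nabla.lTensor A ∘ₗ C.ΔL) (g := C.ΔLA ∘ₗ nabla)
    (eq_of_span_op_smul hS fun η hη a => h.leftCovariant_op_smul (hc η hη) a)

theorem IsConnection.isRightCovariant (h : C.IsConnection nabla) {S : Submodule ℂ E}
    (hS : Submodule.span ℂ {e : E | ∃ η ∈ S, ∃ a : A, e = op a • η} = ⊤)
    (hc : ∀ η ∈ S, nabla.rTensor A (C.ΔR η) = C.ΔRA (nabla η)) : C.IsRightCovariant nabla :=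
  LinearMap.congr_fun (f := nabla.rTensor A ∘ₗ C.ΔR) (g := C.ΔRA ∘ₗ nabla)
    (eq_of_span_op_smul hS fun η hη a => h.rightCovariant_op_smul (hc η hη) a)

theorem IsConnection.ext {nabla' : E →ₗ[ℂ] TensorA A E} (h : C.IsConnection nabla)
    (h' : C.IsConnection nabla') {S : Submodule ℂ E}
    (hS : Submodule.span ℂ {e : E | ∃ η ∈ S, ∃ a : A, e = op a • η} = ⊤)
    (he : ∀ η ∈ S, nabla η = nabla' η) : nabla = nabla' :=
  eq_of_span_op_smul hS fun η hη a => by rw [h, h', he η hη]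

variable (C)

@[simp] theorem d_one : C.d 1 = 0 := by
  have := C.leibniz 1 1
  simpa using this

theorem baseConnection_apply_of_eq {φ : E →ₗ[ℂ] E ⊗[ℂ] A} {m : E} (h : φ m = m ⊗ₜ 1) :
    C.baseConnection φ m = 0 := by
  rw [baseConnection, LinearMap.comp_apply, LinearMap.comp_apply, h, LinearMap.lTensor_tmul, d_one,
    tmul_zero, map_zero]

/-- The connection that vanishes on the right-invariant forms. -/
def rightBase : E →ₗ[ℂ] TensorA A E := C.baseConnection C.rho

theorem rightBase_isConnection : C.IsConnection C.rightBase :=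
  C.baseConnection_isConnection C.rho_op_smul C.rho_reconstruct

theorem rightBase_of_mem {η : E} (h : η ∈ C.rightInv) : C.rightBase η = 0 :=
  C.baseConnection_apply_of_eq (C.rho_of_mem h)

theorem rightBase_isLeftCovariant : C.IsLeftCovariant C.rightBase :=
  C.rightBase_isConnection.isLeftCovariant C.span_rightInv_smul fun η hη => by
    -- The second leg of the left coaction of `η` stays right-invariant, so `nabla` vanishes there
    -- too: `rho` yields terms `e ⊗ 1`, and `d 1 = 0`.
    rw [C.rightBase_of_mem hη, map_zero, rightBase, baseConnection, LinearMap.lTensor_comp,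
      LinearMap.lTensor_comp, LinearMap.comp_apply, LinearMap.comp_apply, C.rho_lTensor_ΔL hη]
    generalize C.ΔL η = u
    induction u using TensorProduct.induction_on with
    | zero => simp
    | add s s' h h' => simp only [map_add, h, h', add_zero]
    | tmul b e => simp

theorem rightBase_isRightCovariant : C.IsRightCovariant C.rightBase :=
  C.rightBase_isConnection.isRightCovariant C.span_rightInv_smul fun η hη => by
    rw [C.mem_rightInv.1 hη, LinearMap.rTensor_tmul, C.rightBase_of_mem hη, zero_tmul, map_zero]

end BaseConnections

/-! ### The inverse antipode `T`, the decomposition `E = ₀E · A`, and the connection that vanishes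
on `₀E` -/

section InverseAntipode

variable {T : A →ₗ[ℂ] A} (hT : ∀ a, antipode ℂ (T a) = a) (hT' : ∀ a, T (antipode ℂ a) = a)

include hT hT'

theorem invAntipode_mul (a b : A) : T (a * b) = T b * T a := by
  rw [← hT' (T b * T a), antipode_mul_antidistrib, hT, hT]

theorem invAntipode_one : T 1 = 1 := by
  have h := hT' 1
  rwa [antipode_one] at h

/-- `S⁻¹(a₍₂₎) a₍₁₎ = ε(a)`. -/
theorem mul_invAntipode_rTensor_comm_comul (a : A) :
    LinearMap.mul' ℂ A (T.rTensor A (TensorProduct.comm ℂ A A (comul a))) =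
      algebraMap ℂ A (counit a) := by
  -- `T` reverses products and undoes `S`, so the identity is `T` applied to the axiom `S(a₍₁₎)a₍₂₎
  -- = ε(a)`.
  have h : ∀ t : A ⊗[ℂ] A, LinearMap.mul' ℂ A (T.rTensor A (TensorProduct.comm ℂ A A t)) =
      T (LinearMap.mul' ℂ A ((antipode ℂ).rTensor A t)) := by
    intro t
    induction t using TensorProduct.induction_on with
    | zero => simp
    | add s s' h h' => simp only [map_add, h, h']
    | tmul a b => simp [invAntipode_mul hT hT', hT']
  rw [h, mul_antipode_rTensor_comul_apply, Algebra.algebraMap_eq_smul_one, map_smul,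
    invAntipode_one hT hT']

/-- `a₍₂₎ S⁻¹(a₍₁₎) = ε(a)`. -/
theorem mul_invAntipode_lTensor_comm_comul (a : A) :
    LinearMap.mul' ℂ A (T.lTensor A (TensorProduct.comm ℂ A A (comul a))) =
      algebraMap ℂ A (counit a) := by
  have h : ∀ t : A ⊗[ℂ] A, LinearMap.mul' ℂ A (T.lTensor A (TensorProduct.comm ℂ A A t)) =
      T (LinearMap.mul' ℂ A ((antipode ℂ).lTensor A t)) := by
    intro t
    induction t using TensorProduct.induction_on with
    | zero => simp
    | add s s' h h' => simp only [map_add, h, h']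
    | tmul a b => simp [invAntipode_mul hT hT', hT']
  rw [h, mul_antipode_lTensor_comul_apply, Algebra.algebraMap_eq_smul_one, map_smul,
    invAntipode_one hT hT']

omit hT hT'

/-- `m ↦ m₍₀₎ S⁻¹(m₍₋₁₎)`, a projection onto the left-invariant forms. -/
def projS (T : A →ₗ[ℂ] A) : E →ₗ[ℂ] E := lift (rAct A E).flip ∘ₗ T.rTensor E ∘ₗ C.ΔL

/-- `m ↦ m₍₀₎₍₀₎ S⁻¹(m₍₀₎₍₋₁₎) ⊗ m₍₋₁₎`. -/
def lamS (T : A →ₗ[ℂ] A) : E →ₗ[ℂ] E ⊗[ℂ] A :=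
  (TensorProduct.comm ℂ A E).toLinearMap ∘ₗ (C.projS T).lTensor A ∘ₗ C.ΔL

include hT hT'

/-- The contribution of `a` is `a₍₂₎T(a₍₁₎) = ε(a)`. The order of the legs is what forces the
inverse antipode here: `a₍₂₎S(a₍₁₎)` need not collapse. -/
theorem projS_op_smul (a : A) (m : E) :
    C.projS T (op a • m) = counit (R := ℂ) a • C.projS T m := by
  have h : ∀ (t : A ⊗[ℂ] A) (c : A) (e : E),
      lift (rAct A E).flip (T.rTensor E (rmulL A E (c ⊗ₜ e) t)) =
      op (T c) • op (LinearMap.mul' ℂ A (T.lTensor A (TensorProduct.comm ℂ A A t))) • e := by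
    intro t c e
    induction t using TensorProduct.induction_on with
    | zero => simp
    | add s s' h h' => simp only [map_add, op_add, add_smul, smul_add, h, h']
    | tmul a b => simp [invAntipode_mul hT hT', mul_smul]
  simp only [projS, LinearMap.comp_apply, ΔL_op_smul]
  generalize C.ΔL m = u
  induction u using TensorProduct.induction_on with
  | zero => simp
  | add s s' h h' => simp only [map_add, smul_add, LinearMap.add_apply, h, h']
  | tmul b e =>
    rw [h, mul_invAntipode_lTensor_comm_comul hT hT', ← MulOpposite.algebraMap_apply,
      algebraMap_smul, smul_comm]
    simp

/-- `projS` turns the second leg of `Δ(a)` into its counit, which leaves the whole of `a` on the `A`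
leg. -/
theorem lamS_op_smul (a : A) (m : E) :
    C.lamS T (op a • m) = ((LinearMap.mul ℂ A).flip a).lTensor E (C.lamS T m) := by
  have h : ∀ (t : A ⊗[ℂ] A) (c : A) (e : E), (C.projS T).lTensor A (rmulL A E (c ⊗ₜ e) t) =
      lift ((TensorProduct.mk ℂ A E).compl₁₂ (LinearMap.mul ℂ A c)
        ((LinearMap.lsmul ℂ E).flip (C.projS T e))) ((counit (R := ℂ) (A := A)).lTensor A t) := by
    intro t c e
    induction t using TensorProduct.induction_on with
    | zero => simp
    | add s s' h h' => simp only [map_add, h, h']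
    | tmul a b => simp [projS_op_smul C hT hT']
  simp only [lamS, LinearMap.comp_apply, ΔL_op_smul]
  generalize C.ΔL m = u
  induction u using TensorProduct.induction_on with
  | zero => simp
  | add s s' h h' => simp only [map_add, LinearMap.add_apply, h, h']
  | tmul b e => simp [h]

/-- By coassociativity the product is `m₍₀₎T(m₍₋₁₎₍₂₎)m₍₋₁₎₍₁₎`, where the last two factors collapse
to the counit. -/
theorem lamS_reconstruct (m : E) : lift (rAct A E) (C.lamS T m) = m := by
  have h₁ : ∀ x : A ⊗[ℂ] E, lift (rAct A E)
      (TensorProduct.comm ℂ A E ((C.projS T).lTensor A x)) =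
      lift ((rAct A E).flip.compl₂ (lift (rAct A E).flip ∘ₗ T.rTensor E))
        (C.ΔL.lTensor A x) := by
    intro x
    induction x using TensorProduct.induction_on with
    | zero => simp
    | add s s' h h' => simp only [map_add, h, h']
    | tmul c e => simp [projS]
  have h₂ : ∀ x : A ⊗[ℂ] E, lift ((rAct A E).flip.compl₂ (lift (rAct A E).flip ∘ₗ
      T.rTensor E)) (TensorProduct.assoc ℂ A A E (comul.rTensor E x)) =
      TensorProduct.lid ℂ E ((counit (R := ℂ) (A := A)).rTensor E x) := by
    intro x
    induction x using TensorProduct.induction_on with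
    | zero => simp
    | add s s' h h' => simp only [map_add, h, h']
    | tmul c e =>
      have h₃ : ∀ t : A ⊗[ℂ] A, lift ((rAct A E).flip.compl₂ (lift (rAct A E).flip ∘ₗ
          T.rTensor E)) (TensorProduct.assoc ℂ A A E (t ⊗ₜ e)) =
          op (LinearMap.mul' ℂ A (T.rTensor A (TensorProduct.comm ℂ A A t))) • e := by
        intro t
        induction t using TensorProduct.induction_on with
        | zero => simp
        | add s s' h h' => simp only [map_add, add_tmul, op_add, add_smul, h, h']
        | tmul a b => simp [mul_smul]
      rw [LinearMap.rTensor_tmul, h₃, mul_invAntipode_rTensor_comm_comul hT hT',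
        ← MulOpposite.algebraMap_apply, algebraMap_smul]
      simp
  rw [lamS, LinearMap.comp_apply, LinearMap.comp_apply, LinearEquiv.coe_coe, h₁, ← coassoc_ΔL, h₂,
    counit_ΔL]

omit hT hT' in
theorem rmulL_mul (s t : A ⊗[ℂ] A) (x : A ⊗[ℂ] E) :
    rmulL A E x (s * t) = rmulL A E (rmulL A E x s) t := by
  induction s using TensorProduct.induction_on with
  | zero => simp
  | add s s' h h' => simp [add_mul, h, h']
  | tmul a b =>
  induction t using TensorProduct.induction_on with
  | zero => simp
  | add s s' h h' => simp [mul_add, h, h']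
  | tmul a' b' =>
  induction x using TensorProduct.induction_on with
  | zero => simp
  | add s s' h h' => simp only [map_add, LinearMap.add_apply, h, h']
  | tmul c e => simp [mul_assoc, mul_smul]

omit hT hT' in
theorem rmulL_one (x : A ⊗[ℂ] E) : rmulL A E x 1 = x := by
  induction x using TensorProduct.induction_on with
  | zero => simp
  | add s s' h h' => simp only [map_add, LinearMap.add_apply, h, h']
  | tmul c e => simp [Algebra.TensorProduct.one_def]

/-- `Δ_E(m) = (1 ⊗ m₍₀₎₍₀₎ S⁻¹(m₍₀₎₍₋₁₎)) Δ(m₍₋₁₎)`. -/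
theorem ΔL_eq_lamS (m : E) : C.ΔL m =
    lift ((rmulL A E).compl₁₂ (TensorProduct.mk ℂ A E 1) comul) (C.lamS T m) := by
  have h₁ : ∀ x : A ⊗[ℂ] E, x =
      (lift (rAct A E).flip).lTensor A (((C.projS T).lTensor A).lTensor A
        (C.ΔL.lTensor A x)) := by
    intro x
    induction x using TensorProduct.induction_on with
    | zero => simp
    | add s s' h h' => simp only [map_add, ← h, ← h']
    | tmul c e =>
      have h₀ : ∀ y : A ⊗[ℂ] E, lift (rAct A E) (TensorProduct.comm ℂ A E y) =
          lift (rAct A E).flip y := by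
        intro y
        induction y using TensorProduct.induction_on with
        | zero => simp
        | add s s' h h' => simp only [map_add, h, h']
        | tmul c e => simp
      have := C.lamS_reconstruct hT hT' e
      simp only [lamS, LinearMap.comp_apply, LinearEquiv.coe_coe, h₀] at this
      simp [this]
  have h₂ : ∀ x : A ⊗[ℂ] E, (lift (rAct A E).flip).lTensor A (((C.projS T).lTensor A).lTensor A
      (TensorProduct.assoc ℂ A A E (comul.rTensor E x))) =
      lift ((rmulL A E).compl₁₂ (TensorProduct.mk ℂ A E 1) comul)
        (TensorProduct.comm ℂ A E ((C.projS T).lTensor A x)) := by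
    intro x
    induction x using TensorProduct.induction_on with
    | zero => simp
    | add s s' h h' => simp only [map_add, h, h']
    | tmul c e =>
      simp only [LinearMap.rTensor_tmul, LinearMap.lTensor_tmul, lift.tmul, comm_tmul,
        LinearMap.compl₁₂_apply, TensorProduct.mk_apply]
      generalize comul (R := ℂ) c = t
      induction t using TensorProduct.induction_on with
      | zero => simp
      | add s s' h h' => simp only [map_add, LinearMap.add_apply, add_tmul, h, h']
      | tmul a b => simp
  conv_lhs => rw [h₁ (C.ΔL m), ← coassoc_ΔL, h₂]
  rfl

/-- Insert `ΔL_eq_lamS` into the coaction of `m₍₀₎T(m₍₋₁₎)`. Multiplicativity of `Δ` combines the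
`A` legs into a single `Δ(m₍₀₎₍₋₁₎T(m₍₋₁₎))`, which coassociativity reduces to a counit; no formula
for `Δ ∘ T` is needed. -/
theorem projS_mem (m : E) : C.projS T m ∈ C.leftInv := by
  let H : A →ₗ[ℂ] E →ₗ[ℂ] A ⊗[ℂ] E :=
    ((rmulL A E).compl₁₂ (TensorProduct.mk ℂ A E 1 ∘ₗ C.projS T) comul).flip
  -- `K` sends `a ⊗ (b ⊗ f)` to `(1 ⊗ projS f) Δ(b T(a))`.
  let K : A ⊗[ℂ] (A ⊗[ℂ] E) →ₗ[ℂ] A ⊗[ℂ] E :=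
    lift H ∘ₗ (LinearMap.mul' ℂ A ∘ₗ T.lTensor A ∘ₗ
      (TensorProduct.comm ℂ A A).toLinearMap).rTensor E ∘ₗ
      (TensorProduct.assoc ℂ A A E).symm.toLinearMap
  have h₁ : ∀ x : A ⊗[ℂ] E, C.ΔL (lift (rAct A E).flip (T.rTensor E x)) =
      K (C.ΔL.lTensor A x) := by
    intro x
    induction x using TensorProduct.induction_on with
    | zero => simp
    | add s s' h h' => simp only [map_add, h, h']
    | tmul c e =>
      simp only [LinearMap.rTensor_tmul, lift.tmul, LinearMap.flip_apply, rAct_apply, ΔL_op_smul,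
        LinearMap.lTensor_tmul]
      conv_lhs => rw [ΔL_eq_lamS C hT hT', lamS, LinearMap.comp_apply, LinearMap.comp_apply]
      generalize C.ΔL e = u
      induction u using TensorProduct.induction_on with
      | zero => simp
      | add s s' h h' => simp only [map_add, LinearMap.add_apply, tmul_add, h, h']
      | tmul b f => simp [K, H, rmulL_mul]
  have h₂ : ∀ x : A ⊗[ℂ] E, K (TensorProduct.assoc ℂ A A E (comul.rTensor E x)) =
      1 ⊗ₜ C.projS T (TensorProduct.lid ℂ E ((counit (R := ℂ) (A := A)).rTensor E x)) := by
    intro x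
    induction x using TensorProduct.induction_on with
    | zero => simp
    | add s s' h h' => simp only [map_add, tmul_add, h, h']
    | tmul c e =>
      simp [K, H, mul_invAntipode_lTensor_comm_comul hT hT', Algebra.algebraMap_eq_smul_one,
        rmulL_one]
  rw [mem_leftInv]
  conv_lhs => rw [projS, LinearMap.comp_apply, LinearMap.comp_apply, h₁, ← coassoc_ΔL, h₂,
    counit_ΔL]

theorem lamS_of_mem {ω : E} (h : ω ∈ C.leftInv) : C.lamS T ω = ω ⊗ₜ 1 := by
  have h₁ : C.projS T ω = ω := by simp [projS, C.mem_leftInv.1 h, invAntipode_one hT hT']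
  simp [lamS, C.mem_leftInv.1 h, h₁]

/-- `E = ₀E · A`. -/
theorem span_leftInv_smul :
    Submodule.span ℂ {e : E | ∃ ω ∈ C.leftInv, ∃ a : A, e = op a • ω} = ⊤ := by
  rw [eq_top_iff]
  rintro m -
  rw [← C.lamS_reconstruct hT hT' m, lamS, LinearMap.comp_apply, LinearMap.comp_apply]
  generalize C.ΔL m = u
  induction u using TensorProduct.induction_on with
  | zero => simp
  | add s s' h h' => simp only [map_add]; exact add_mem h h'
  | tmul b e => exact Submodule.subset_span ⟨_, C.projS_mem hT hT' e, b, rfl⟩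

omit hT hT' in
/-- The connection that vanishes on the left-invariant forms, where `T` is the inverse of the
antipode. -/
def leftBase (T : A →ₗ[ℂ] A) : E →ₗ[ℂ] TensorA A E := C.baseConnection (C.lamS T)

theorem leftBase_isConnection : C.IsConnection (C.leftBase T) :=
  C.baseConnection_isConnection (C.lamS_op_smul hT hT') (C.lamS_reconstruct hT hT')

theorem leftBase_of_mem {ω : E} (h : ω ∈ C.leftInv) : C.leftBase T ω = 0 :=
  C.baseConnection_apply_of_eq (C.lamS_of_mem hT hT' h)

theorem leftBase_isLeftCovariant : C.IsLeftCovariant (C.leftBase T) :=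
  (C.leftBase_isConnection hT hT').isLeftCovariant (C.span_leftInv_smul hT hT') fun ω hω => by
    rw [C.mem_leftInv.1 hω, LinearMap.lTensor_tmul, C.leftBase_of_mem hT hT' hω, tmul_zero,
      map_zero]

theorem leftBase_isRightCovariant : C.IsRightCovariant (C.leftBase T) :=
  (C.leftBase_isConnection hT hT').isRightCovariant (C.span_leftInv_smul hT hT') fun ω hω => by
    -- Reinserting `projL` makes the first leg of the right coaction visibly left-invariant, so the
    -- connection vanishes on it.
    rw [C.leftBase_of_mem hT hT' hω, map_zero, ← (C.projL_rTensor_ΔR hω).1]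
    generalize C.ΔR ω = u
    induction u using TensorProduct.induction_on with
    | zero => simp
    | add s s' h h' => simp only [map_add, h, h', add_zero]
    | tmul e b => simp [C.leftBase_of_mem hT hT' (C.projL_mem e)]

/-- `E ⊗_A E = ₀(E ⊗_A E) · A`. -/
theorem span_rActA_leftInvA :
    Submodule.span ℂ {y | ∃ x ∈ C.leftInvA, ∃ a : A, y = rActA a x} = ⊤ := by
  rw [eq_top_iff]
  rintro x -
  induction x using tensorA_induction with
  | zero => simp
  | add x y hx hy => exact add_mem hx hy
  | tmul m n =>
    have hm : m ∈ Submodule.span ℂ {e : E | ∃ ω ∈ C.leftInv, ∃ a : A, e = op a • ω} :=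
      C.span_leftInv_smul hT hT' ▸ Submodule.mem_top
    induction hm using Submodule.span_induction with
    | zero => simp
    | add x y _ _ hx hy => rw [add_tmulA]; exact add_mem hx hy
    | smul c x _ hx => rw [smul_tmulA]; exact Submodule.smul_mem _ _ hx
    | mem m hm =>
      obtain ⟨ω, hω, a, rfl⟩ := hm
      -- Slide the coefficient to the right factor, `ωa ⊗_A n = ω ⊗_A an`, and then expand `an`
      -- along `₀E · A`.
      rw [tmulA_balanced]
      generalize a • n = n'
      have hn : n' ∈ Submodule.span ℂ {e : E | ∃ ω ∈ C.leftInv, ∃ a : A, e = op a • ω} :=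
        C.span_leftInv_smul hT hT' ▸ Submodule.mem_top
      induction hn using Submodule.span_induction with
      | zero => simp
      | add x y _ _ hx hy => rw [tmulA_add]; exact add_mem hx hy
      | smul c x _ hx => rw [tmulA_smul]; exact Submodule.smul_mem _ _ hx
      | mem n hn =>
        obtain ⟨ω', hω', b, rfl⟩ := hn
        exact Submodule.subset_span ⟨_, C.tmulA_mem_leftInvA hω hω', b, (rActA_tmulA _ _ _).symm⟩

end InverseAntipode

/-! ### `F` is the range of `σ - 1`, and `Q` is bijective -/

section Complement

/-- For an eigenvector `z` with eigenvalue `μ ≠ 1`, right linearity of `σ` makes `za` an eigenvector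
too, so `za` is the image of `(μ - 1)⁻¹ za`. -/
theorem F_le_range : C.F ≤ LinearMap.range (C.braiding - LinearMap.id) := by
  rw [F, Submodule.span_le]
  rintro _ ⟨_, ⟨y, hy, rfl⟩, a, rfl⟩
  suffices (⨆ μ : ℂ, ⨆ _ : μ ≠ 1, C.braiding₀.eigenspace μ) ≤
      (LinearMap.range (C.braiding - LinearMap.id)).comap (rActA a ∘ₗ C.leftInvA.subtype) from
    this hy
  refine iSup₂_le fun μ hμ z hz => ⟨(μ - 1)⁻¹ • rActA a z, ?_⟩
  have hz' : C.braiding z = μ • (z : TensorA A E) :=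
    congrArg Subtype.val (Module.End.mem_eigenspace_iff.1 hz)
  have h₁ : (C.braiding - LinearMap.id : Module.End ℂ (TensorA A E)) (rActA a z) =
      (μ - 1) • rActA a (z : TensorA A E) := by
    rw [LinearMap.sub_apply, braiding_rActA, hz', map_smul, LinearMap.id_apply, sub_smul, one_smul]
  rw [map_smul, h₁, smul_smul, inv_mul_cancel₀ (sub_ne_zero.2 hμ), one_smul]
  rfl

/-- Split `x` in `xa` into eigenvectors of `₀σ`: eigenvalue `1` contributes to the kernel by right
linearity, the others to `F`. The generation hypothesis `hA` is supplied by the inverse antipode. -/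
theorem ker_sup_F (hσ : C.BraidingDiagonalisable)
    (hA : Submodule.span ℂ {y | ∃ x ∈ C.leftInvA, ∃ a : A, y = rActA a x} = ⊤) :
    LinearMap.ker (C.braiding - LinearMap.id) ⊔ C.F = ⊤ := by
  rw [eq_top_iff, ← hA, Submodule.span_le]
  rintro _ ⟨x, hx, a, rfl⟩
  suffices (⨆ μ : ℂ, C.braiding₀.eigenspace μ) ≤
      (LinearMap.ker (C.braiding - LinearMap.id) ⊔ C.F).comap
        (rActA a ∘ₗ C.leftInvA.subtype) from
    this (x := ⟨x, hx⟩) ((hσ : (⨆ μ : ℂ, C.braiding₀.eigenspace μ) = ⊤) ▸ Submodule.mem_top)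
  refine iSup_le fun μ z hz => ?_
  by_cases hμ : μ = 1
  · refine Submodule.mem_sup_left ?_
    have hz' : C.braiding z = μ • (z : TensorA A E) :=
      congrArg Subtype.val (Module.End.mem_eigenspace_iff.1 hz)
    rw [LinearMap.mem_ker, LinearMap.comp_apply, LinearMap.sub_apply, braiding_rActA,
      Submodule.subtype_apply, hz', hμ, one_smul, LinearMap.id_apply, sub_self]
  · refine Submodule.mem_sup_right (Submodule.subset_span ⟨z, ?_, a, rfl⟩)
    exact ⟨z, Submodule.mem_iSup_of_mem μ (Submodule.mem_iSup_of_mem hμ hz), rfl⟩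

variable {C}

/-- Write an element of the range as `k + f` with `k` in the kernel and `f ∈ F`. Since `F` is
contained in the range, `k` lies in both kernel and range, so it vanishes. -/
theorem F_eq_range (hK : LinearMap.ker (C.braiding - LinearMap.id) ⊔ C.F = ⊤)
    (hσ : C.BraidingDiagonalisable) :
    C.F = LinearMap.range (C.braiding - LinearMap.id) := by
  refine le_antisymm C.F_le_range fun x hx => ?_
  have hx' : x ∈ LinearMap.ker (C.braiding - LinearMap.id) ⊔ C.F := hK ▸ Submodule.mem_top
  obtain ⟨k, hk, f, hf, rfl⟩ := Submodule.mem_sup.1 hx'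
  have hk' : k ∈ LinearMap.range (C.braiding - LinearMap.id) := by
    simpa using sub_mem hx (C.F_le_range hf)
  rw [Submodule.disjoint_def.1 (C.isCompl_braiding hσ).disjoint k hk hk', zero_add]
  exact hf

/-- `F` is a complement of `ker (σ - 1)`, the kernel of the quotient map `∧`. -/
theorem Q_bijective (hK : LinearMap.ker (C.braiding - LinearMap.id) ⊔ C.F = ⊤)
    (hσ : C.BraidingDiagonalisable) : Function.Bijective C.Q := by
  constructor
  · rw [← LinearMap.ker_eq_bot, LinearMap.ker_eq_bot']
    intro x hx
    exact Subtype.ext (Submodule.disjoint_def.1 (C.isCompl_braiding hσ).disjoint x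
      ((Submodule.Quotient.mk_eq_zero _).1 hx) (C.F_le_range x.2))
  · intro y
    obtain ⟨x, rfl⟩ := Submodule.mkQ_surjective _ y
    have hx : x ∈ LinearMap.ker (C.braiding - LinearMap.id) ⊔ C.F := hK ▸ Submodule.mem_top
    obtain ⟨k, hk, f, hf, rfl⟩ := Submodule.mem_sup.1 hx
    refine ⟨⟨f, hf⟩, (Submodule.Quotient.eq _).2 ?_⟩
    simpa using neg_mem hk

end Complement

end BicovariantCalculus

end QuantumCalculus

end

/-! ### Existence, and the distinguished connection `∇₀` -/

theorem mainTheorem4 {A : Type*} [Ring A] [HopfAlgebra ℂ A]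
    {E : Type*} [AddCommGroup E] [Module ℂ E] [Module A E] [Module Aᵐᵒᵖ E]
    [IsScalarTower ℂ A E] [IsScalarTower ℂ Aᵐᵒᵖ E] [SMulCommClass A Aᵐᵒᵖ E]
    (C : QuantumCalculus.BicovariantCalculus A E) [FiniteDimensional ℂ C.leftInv]
    (hσ : C.BraidingDiagonalisable) :
    (∃ nabla : E →ₗ[ℂ] QuantumCalculus.BicovariantCalculus.TensorA A E,
      C.IsConnection nabla ∧ C.IsLeftCovariant nabla ∧ C.IsRightCovariant nabla ∧
        C.torsion nabla = 0) ∧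
    (Function.Bijective (HopfAlgebra.antipode ℂ : A →ₗ[ℂ] A) →
      Function.Bijective C.Q ∧
      (∃! nabla₀ : E →ₗ[ℂ] QuantumCalculus.BicovariantCalculus.TensorA A E,
        C.IsConnection nabla₀ ∧
          ∀ ω ∈ C.leftInv, ∃ x : C.F, C.Q x = -C.dForm ω ∧ nabla₀ ω = x) ∧
      (∀ nabla₀ : E →ₗ[ℂ] QuantumCalculus.BicovariantCalculus.TensorA A E,
        C.IsConnection nabla₀ →
        (∀ ω ∈ C.leftInv, ∃ x : C.F, C.Q x = -C.dForm ω ∧ nabla₀ ω = x) →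
        C.IsLeftCovariant nabla₀ ∧ C.IsRightCovariant nabla₀ ∧ C.torsion nabla₀ = 0)) := by
  obtain ⟨r, hr⟩ := QuantumCalculus.exists_isGroupInverse (C.isCompl_braiding hσ)
  -- The connection built from `E₀` is used here because it exists without inverting the antipode.
  refine ⟨⟨C.torsionless hr C.rightBase, C.rightBase_isConnection.torsionless hr,
    C.rightBase_isLeftCovariant.torsionless hr, C.rightBase_isRightCovariant.torsionless hr,
    C.torsion_torsionless hr _⟩, fun hS => ?_⟩
  let e := LinearEquiv.ofBijective (HopfAlgebra.antipode ℂ : A →ₗ[ℂ] A) hS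
  have hT : ∀ a, HopfAlgebra.antipode ℂ (e.symm.toLinearMap a) = a := e.apply_symm_apply
  have hT' : ∀ a, e.symm.toLinearMap (HopfAlgebra.antipode ℂ a) = a := e.symm_apply_apply
  have hK := C.ker_sup_F hσ (C.span_rActA_leftInvA hT hT')
  have hQ := QuantumCalculus.BicovariantCalculus.Q_bijective hK hσ
  have hc := (C.leftBase_isConnection hT hT').torsionless hr
  have hv : ∀ ω ∈ C.leftInv, ∃ x : C.F, C.Q x = -C.dForm ω ∧
      C.torsionless hr (C.leftBase e.symm.toLinearMap) ω = x := by
    intro ω hω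
    -- The base connection vanishes on `ω`, so only the lift `-dLift ω` remains; it lies in `range
    -- (σ - 1) = F` and its wedge is `-dω`.
    refine ⟨⟨-C.dLift hr ω, ?_⟩, ?_, ?_⟩
    · rw [QuantumCalculus.BicovariantCalculus.F_eq_range hK hσ]
      exact neg_mem (C.dLift_mem_range hr ω)
    · exact (map_neg C.wedge _).trans (congrArg _ (C.wedge_dLift hr ω))
    · simp [C.torsionless_apply, C.leftBase_of_mem hT hT' hω]
  have hu : ∀ nabla : E →ₗ[ℂ] QuantumCalculus.BicovariantCalculus.TensorA A E,
      C.IsConnection nabla → (∀ ω ∈ C.leftInv, ∃ x : C.F, C.Q x = -C.dForm ω ∧ nabla ω = x) →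
      nabla = C.torsionless hr (C.leftBase e.symm.toLinearMap) := by
    intro nabla h h'
    -- A connection is determined by its values on `₀E`, and injectivity of `Q` fixes those values.
    refine h.ext hc (C.span_leftInv_smul hT hT') fun ω hω => ?_
    obtain ⟨x, hx, hx'⟩ := h' ω hω
    obtain ⟨y, hy, hy'⟩ := hv ω hω
    rw [hx', hy', hQ.injective (hx.trans hy.symm)]
  refine ⟨hQ, ⟨_, ⟨hc, hv⟩, fun nabla h => hu nabla h.1 h.2⟩, fun nabla h h' => ?_⟩
  rw [hu nabla h h']
  exact ⟨(C.leftBase_isLeftCovariant hT hT').torsionless hr,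
    (C.leftBase_isRightCovariant hT hT').torsionless hr, C.torsion_torsionless hr _⟩
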